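/- All graphs and multigraphs are finite and have at least one vertex; multigraphs may have loops and parallel edges. For a (simple) graph $H$ and integers $j\ge 0$, $k\ge 1$, let $G^j_k(H)$ be the graph whose vertices are the proper $k$-colorings of $H$ (with colors from a fixed set of $k$ colors), two distinct colorings being adjacent if $H$ contains a connected subgraph on at most $j$ vertices that contains every vertex on which the two colorings differ. Let $g_k(H)$ be the least $j$ such that $G^j_k(H)$ is connected, and let $h_k(H)$ be the least $j$ such that $G^j_k(H)$ is Hamiltonian. Subdividing an edge $s$ times means replacing it by a path with the same ends (by a cycle through its end, if it is a loop) that has $s$ new internal vertices. Theorem. Let $H$ be a graph obtained from a multigraph $M$ by subdividing each edge of $M$ at least $\ell$ times (different edges may be subdivided different numbers of times). (1) If $\ell=2$ and $M$ is loopless, then $g_3(H)\le 2$ and $h_4(H)=1$. (2) If $\ell=3$ (and $M$ may have loops), then $h_3(H)\le 2$. -/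

import Mathlib

/-- The `j`-localized `k`-coloring graph of `H`: its vertices are the proper colorings of `H` with
colors `0, …, k - 1`, and two distinct colorings are adjacent if `H` has a connected subgraph on at
most `j` vertices which contains all the vertices where the colorings differ. -/
def SimpleGraph.localColoringGraph {V : Type*} (H : SimpleGraph V) (j k : ℕ) :
    SimpleGraph (H.Coloring (Fin k)) where
  Adj φ ψ := φ ≠ ψ ∧
    ∃ F : H.Subgraph, F.Connected ∧ F.verts.encard ≤ j ∧ ∀ v, φ v ≠ ψ v → v ∈ F.verts
  symm := ⟨by
    rintro φ ψ ⟨hne, F, hF, hcard, hv⟩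
    exact ⟨hne.symm, F, hF, hcard, fun v h => hv v h.symm⟩⟩
  loopless := ⟨fun _ h => h.1 rfl⟩

/-- The `k`-color mixing number of `H`: the least `j` such that the `j`-localized `k`-coloring
graph of `H` is connected (and `⊤` if there is no such `j`). -/
noncomputable def SimpleGraph.mixingNumber {V : Type*} (H : SimpleGraph V) (k : ℕ) : ℕ∞ :=
  ⨅ j ∈ {j : ℕ | (H.localColoringGraph j k).Connected}, (j : ℕ∞)

open Classical in
/-- The `k`-color Gray code number of `H`: the least `j` such that the `j`-localized `k`-coloring
graph of `H` is Hamiltonian (and `⊤` if there is no such `j`). -/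
noncomputable def SimpleGraph.grayCodeNumber {V : Type*} [Fintype V] (H : SimpleGraph V) (k : ℕ) :
    ℕ∞ :=
  ⨅ j ∈ {j : ℕ | (H.localColoringGraph j k).IsHamiltonian}, (j : ℕ∞)

/-- The `i`-th vertex of the path of length `s e + 1` from `x e` to `y e` that replaces the edge
`e`: vertex `0` is `x e`, vertex `s e + 1` is `y e`, and vertices `1, …, s e` are the new ones. -/
def subdivisionVertex {V E : Type*} (x y : E → V) (s : E → ℕ) (e : E) :
    ℕ → V ⊕ (Σ e : E, Fin (s e))
  | 0 => Sum.inl (x e)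
  | i + 1 => if h : i < s e then Sum.inr ⟨e, ⟨i, h⟩⟩ else Sum.inl (y e)

/-- Given a multigraph with vertices `V` and edges `E`, where the edge `e` has the ends `x e` and
`y e` (equal if `e` is a loop), the graph obtained by subdividing each edge `e` exactly `s e` times,
that is, by replacing each `e` by a path from `x e` to `y e` through `s e` new vertices.
(The result is simple when `1 ≤ s e` for every `e`, and `2 ≤ s e` for every loop `e`.) -/
def subdivisionGraph {V E : Type*} (x y : E → V) (s : E → ℕ) :
    SimpleGraph (V ⊕ (Σ e : E, Fin (s e))) :=
  SimpleGraph.fromRel fun a b => ∃ e : E, ∃ i : ℕ, i ≤ s e ∧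
    a = subdivisionVertex x y s e i ∧ b = subdivisionVertex x y s e (i + 1)

/-- `H` is (isomorphic to a graph) obtained from the multigraph `M` by subdividing each edge of `M`
at least `l` times; different edges may be subdivided different numbers of times. -/
def SimpleGraph.IsSubdividedAtLeast {W α β : Type*} (H : SimpleGraph W) (l : ℕ) (M : Graph α β) :
    Prop :=
  ∃ (x y : M.edgeSet → M.vertexSet) (s : M.edgeSet → ℕ),
    (∀ e : M.edgeSet, M.IsLink e (x e) (y e)) ∧ (∀ e, l ≤ s e) ∧ Nonempty (H ≃g subdivisionGraph x y s)

/-! The graph grows from one vertex by attaching paths to a part `A` already built: old vertices as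
isolated points, pendant paths along an edge, and an ear that completes the edge. A coloring of the
enlarged part is a coloring `f` of `A` together with a word on the new path, and the admissible
words depend only on the state `(f x, f y)` at the two attachment vertices. So the colorings are
fibred over those of `A`, with finitely many types of fibre. A word admissible over both ends of a
base step can serve as a port: the base step is taken while the word stays fixed.

For connectivity it is enough that every fibre is connected and that ports exist
(`PathAttached.connectsOn`).

For Hamiltonicity, follow the Hamiltonian cycle of the base and cross each fibre by a Hamiltonian
path from the entering port to a leaving one. `TotalCheck` says that this never gets stuck, but the
tour must also close up. The device is a funnel: a window of at most three consecutive fibres at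
whose end one port `q` can be reached from every port entering the window. Start at `q` and go round
the rest of the cycle; whichever entering port `p` is met on return, the funnel leads from `p` to
`q`. This is `HasHamCycle.lift`.

A funnel exists because the state sequence is periodic and takes enough values to contain a suitable
pattern (`exists_triple`, `exists_change_to_offDiag`, `exists_change_from_diag`), for which a finite
computation finds the port. With four colors, pendant vertices and ears of two new vertices suffice;
with three colors and `j = 2`, pendant pairs and ears of three or four new vertices, which cover
both parities of `s e`. -/

/-! ### Lifting Hamiltonian cycles along a fibration -/

/-- `r` has a Hamiltonian cycle on the set `A`, given as a periodic enumeration of `A`. -/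
def HasHamCycle {α : Type*} (r : α → α → Prop) (A : Set α) : Prop :=
  ∃ (N : ℕ) (c : ℕ → α), 3 ≤ N ∧ (∀ n, c (n + N) = c n) ∧ (∀ i j, i < j → j < i + N → c i ≠ c j) ∧
    (∀ x, x ∈ A ↔ ∃ n, c n = x) ∧ ∀ n, r (c n) (c (n + 1))

/-- `r` has a Hamiltonian path from `p` to `q` on the elements of the list `X`. -/
def HasHamPath {α : Type*} (r : α → α → Prop) (X : List α) (p q : α) : Prop :=
  ∃ l : List α, l.IsChain r ∧ l.Nodup ∧ (∀ x, x ∈ l ↔ x ∈ X) ∧ l.head? = some p ∧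
    l.getLast? = some q

theorem HasHamCycle.of_list {α : Type*} {r : α → α → Prop} {A : Set α} (l : List α)
    (h3 : 3 ≤ l.length) (hnd : l.Nodup) (hch : l.IsChain r) (hmem : ∀ x, x ∈ A ↔ x ∈ l)
    (hlast : ∀ x ∈ l.getLast?, ∀ y ∈ l.head?, r x y) : HasHamCycle r A := by
  have hpos : 0 < l.length := by omega
  refine ⟨l.length, fun n => l[n % l.length]'(Nat.mod_lt _ hpos), h3, fun n => by simp, ?_, ?_, ?_⟩
  · intro i j hij hji h
    rw [hnd.getElem_inj_iff] at h
    have h1 : (j - i) % l.length = 0 := Nat.sub_mod_eq_zero_of_mod_eq h.symm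
    rw [Nat.mod_eq_of_lt (by omega)] at h1
    omega
  · intro x
    rw [hmem, List.mem_iff_getElem]
    constructor
    · rintro ⟨n, hn, rfl⟩
      exact ⟨n, by simp [Nat.mod_eq_of_lt hn]⟩
    · rintro ⟨n, rfl⟩
      exact ⟨_, Nat.mod_lt _ hpos, rfl⟩
  · intro n
    have hn := Nat.mod_lt n hpos
    rcases Nat.lt_or_ge (n % l.length + 1) l.length with h | h
    · have h2 : (n + 1) % l.length = n % l.length + 1 := by
        rw [Nat.add_mod, Nat.mod_eq_of_lt (by omega : 1 < l.length), Nat.mod_eq_of_lt h]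
      simp only [h2]
      exact List.isChain_iff_getElem.1 hch _ h
    · have h1 : n % l.length = l.length - 1 := by omega
      have h2 : (n + 1) % l.length = 0 := by
        rw [Nat.add_mod, h1, Nat.mod_eq_of_lt (by omega : 1 < l.length),
          Nat.sub_add_cancel (by omega), Nat.mod_self]
      simp only [h1, h2]
      refine hlast _ ?_ _ ?_
      · rw [List.getLast?_eq_getElem?]; simp [hpos]
      · rw [List.head?_eq_getElem?]; simp [hpos]

/-- The elements of a family of fibres can be traversed along the bases `v i, …, v (i + n - 1)`,
starting at `p`, ending at `q`, and changing the base only at ports. -/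
def FibreReach {S Φ : Type*} (HP : S → Φ → Φ → Prop) (L : S → S → List Φ) (v : ℕ → S) :
    ℕ → ℕ → Φ → Φ → Prop
  | _, 0, p, q => p = q
  | i, n + 1, p, q => ∃ u ∈ L (v i) (v (i + 1)), HP (v i) p u ∧ FibreReach HP L v (i + 1) n u q

theorem FibreReach.trans {S Φ : Type*} {HP : S → Φ → Φ → Prop} {L : S → S → List Φ} {v : ℕ → S}
    {i n m : ℕ} {p q u : Φ} (h : FibreReach HP L v i n p q)
    (h' : FibreReach HP L v (i + n) m q u) : FibreReach HP L v i (n + m) p u := by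
  induction n generalizing i p with
  | zero =>
    obtain rfl : p = q := h
    simpa using h'
  | succ n ih =>
    obtain ⟨w, hw, hpw, h⟩ := h
    rw [Nat.add_right_comm]
    exact ⟨w, hw, hpw, ih h (by rwa [Nat.add_assoc, Nat.add_comm 1 n])⟩

theorem exists_fibreReach {S Φ : Type*} {HP : S → Φ → Φ → Prop} {L : S → S → List Φ}
    {X : S → List Φ} {v : ℕ → S} (hL : ∀ i, ∀ p ∈ L (v i) (v (i + 1)), p ∈ X (v (i + 1)))
    (hT : ∀ i, ∀ p ∈ X (v i), ∃ q ∈ L (v i) (v (i + 1)), HP (v i) p q)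
    (i n : ℕ) (p : Φ) (hp : p ∈ L (v i) (v (i + 1))) :
    ∃ q ∈ L (v (i + n)) (v (i + n + 1)), FibreReach HP L v (i + 1) n p q := by
  induction n generalizing i p with
  | zero => exact ⟨p, hp, rfl⟩
  | succ n ih =>
    obtain ⟨u, hu, hpu⟩ := hT _ _ (hL _ _ hp)
    obtain ⟨q, hq, h⟩ := ih (i + 1) u hu
    rw [Nat.add_right_comm i 1 n] at hq
    exact ⟨q, hq, u, hu, hpu, h⟩

/-- At most `N` consecutive base points are distinct, so the traversed fibres are disjoint and their
paths concatenate. The final port `q` ends the fibre at index `i + n - 1`; the fibre at `i + n` is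
not traversed. -/
theorem FibreReach.exists_list {α γ S Φ : Type*} {r : γ → γ → Prop} {rΦ : Φ → Φ → Prop}
    {X : S → List Φ} {L : S → S → List Φ} {st : α → S} {ext : α → Φ → γ} {c : ℕ → α} {N : ℕ}
    (hc : ∀ i j, i < j → j < i + N → c i ≠ c j)
    (hinj : ∀ i j p q, p ∈ X (st (c i)) → q ∈ X (st (c j)) → ext (c i) p = ext (c j) q →
      c i = c j ∧ p = q)
    (hr : ∀ i, ∀ p q, rΦ p q → r (ext (c i) p) (ext (c i) q))
    (hstep : ∀ i, ∀ p ∈ L (st (c i)) (st (c (i + 1))), r (ext (c i) p) (ext (c (i + 1)) p))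
    {i n : ℕ} (hn : n ≤ N) {p q : Φ}
    (h : FibreReach (fun s => HasHamPath rΦ (X s)) L (fun i => st (c i)) i n p q) :
    ∃ l : List γ, l.IsChain r ∧ l.Nodup ∧
      (∀ x, x ∈ l ↔ ∃ m < n, ∃ w ∈ X (st (c (i + m))), ext (c (i + m)) w = x) ∧
      (0 < n → l.head? = some (ext (c i) p) ∧ l.getLast? = some (ext (c (i + n - 1)) q)) := by
  induction n generalizing i p with
  | zero => exact ⟨[], by simp⟩
  | succ n ih =>
    obtain ⟨u, hu, ⟨l₁, hch, hnd, hmem, hhead, hlast⟩, h⟩ := h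
    obtain ⟨l₂, hch₂, hnd₂, hmem₂, hends⟩ := ih (by omega) h
    refine ⟨l₁.map (ext (c i)) ++ l₂, ?_, ?_, ?_, fun _ => ⟨?_, ?_⟩⟩
    · rw [List.isChain_append]
      refine ⟨?_, hch₂, ?_⟩
      · rw [List.isChain_map]
        exact hch.imp fun _ _ => hr i _ _
      · intro x hx y hy
        rw [List.getLast?_map, hlast] at hx
        rcases Nat.eq_zero_or_pos n with rfl | hn0
        · cases l₂ with
          | nil => simp at hy
          | cons z l => simpa using hmem₂ z
        · rw [(hends hn0).1] at hy
          simp only [Option.map_some, Option.mem_def, Option.some.injEq] at hx hy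
          rw [← hx, ← hy]
          exact hstep i u hu
    · rw [List.nodup_append]
      refine ⟨?_, hnd₂, ?_⟩
      · refine hnd.map_on ?_
        intro a ha b hb hab
        exact (hinj i i a b ((hmem a).1 ha) ((hmem b).1 hb) hab).2
      · intro a ha b hb hab
        obtain ⟨a', ha', rfl⟩ := List.mem_map.1 ha
        obtain ⟨m, hm, w, hw, rfl⟩ := (hmem₂ b).1 hb
        exact hc i (i + 1 + m) (by omega) (by omega) (hinj _ _ _ _ ((hmem a').1 ha') hw hab).1
    · intro x
      rw [List.mem_append, List.mem_map, hmem₂]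
      constructor
      · rintro (⟨w, hw, rfl⟩ | ⟨m, hm, w, hw, rfl⟩)
        · exact ⟨0, by omega, w, (hmem w).1 hw, rfl⟩
        · refine ⟨m + 1, by omega, w, ?_⟩
          rw [show i + (m + 1) = i + 1 + m by omega]
          exact ⟨hw, rfl⟩
      · rintro ⟨m, hm, w, hw, rfl⟩
        rcases m with _ | m
        · exact Or.inl ⟨w, (hmem w).2 hw, rfl⟩
        · rw [show i + (m + 1) = i + 1 + m by omega] at *
          exact Or.inr ⟨m, by omega, w, hw, rfl⟩
    · cases l₁ with
      | nil => simp at hhead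
      | cons a l => simp at hhead; simp [hhead]
    · rcases Nat.eq_zero_or_pos n with rfl | hn0
      · obtain rfl : u = q := h
        have : l₂ = [] := List.eq_nil_iff_forall_not_mem.2 fun x hx => by simpa using (hmem₂ x).1 hx
        simp [this, List.getLast?_map, hlast]
      · rw [List.getLast?_append, (hends hn0).2, show i + 1 + n - 1 = i + (n + 1) - 1 by omega]
        rfl

/-- A Hamiltonian cycle on `A` lifts to a Hamiltonian cycle on a set fibred over `A`, if every fibre
has enough Hamiltonian paths between ports, and at some place a port that is reached from all ports
a few steps before. -/
theorem HasHamCycle.lift {α γ S Φ : Type*} {rα : α → α → Prop} {r : γ → γ → Prop}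
    {rΦ : Φ → Φ → Prop} {A : Set α} {A' : Set γ}
    {X : S → List Φ} {L : S → S → List Φ} {st : α → S} {ext : α → Φ → γ} {tr : S → S → Prop}
    (hA : HasHamCycle rα A)
    (hinj : ∀ f ∈ A, ∀ g ∈ A, ∀ p ∈ X (st f), ∀ q ∈ X (st g), ext f p = ext g q → f = g ∧ p = q)
    (hmem : ∀ x, x ∈ A' ↔ ∃ f ∈ A, ∃ p ∈ X (st f), ext f p = x)
    (hr : ∀ f ∈ A, ∀ p q, rΦ p q → r (ext f p) (ext f q))
    (hstep : ∀ f ∈ A, ∀ g ∈ A, rα f g → ∀ p, r (ext f p) (ext g p))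
    (htr : ∀ f ∈ A, ∀ g ∈ A, rα f g → tr (st f) (st g))
    (hL : ∀ σ τ, ∀ p ∈ L σ τ, p ∈ X τ)
    (hT : ∀ τ ρ, tr τ ρ → ∀ p ∈ X τ, ∃ q ∈ L τ ρ, HasHamPath rΦ (X τ) p q)
    (hclose : ∀ (v : ℕ → S) (N : ℕ), 0 < N → (∀ n, v (n + N) = v n) → (∀ n, tr (v n) (v (n + 1))) →
      (∀ f ∈ A, ∃ n, v n = st f) → ∃ i n, n ≤ 3 ∧ ∃ q ∈ L (v (i + n)) (v (i + n + 1)),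
        ∀ p ∈ L (v i) (v (i + 1)),
          FibreReach (fun s => HasHamPath rΦ (X s)) L v (i + 1) n p q) :
    HasHamCycle r A' := by
  obtain ⟨N, c, hN, hper, hcinj, hcmem, hcr⟩ := hA
  have hcA : ∀ i, c i ∈ A := fun i => (hcmem _).2 ⟨i, rfl⟩
  have hctr : ∀ n, tr (st (c n)) (st (c (n + 1))) := fun n => htr _ (hcA _) _ (hcA _) (hcr n)
  obtain ⟨i, n, hn, q, hq, hall⟩ := hclose (fun i => st (c i)) N (by omega)
    (fun n => by rw [hper]) hctr (fun f hf => by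
      obtain ⟨n, rfl⟩ := (hcmem f).1 hf
      exact ⟨n, rfl⟩)
  -- Continue greedily from `q` through the other `N - n` fibres, where `n ≤ 3 ≤ N`; by periodicity
  -- the port `p` reached enters the window again.
  obtain ⟨p, hp, hqp⟩ := exists_fibreReach (X := X) (v := fun i => st (c i)) (L := L)
    (HP := fun s => HasHamPath rΦ (X s))
    (fun i p hp => hL _ _ p hp) (fun i p hp => hT _ _ (hctr i) p hp) (i + n) (N - n) q hq
  have e1 : i + n + (N - n) = i + N := by omega
  have e2 : i + N + 1 = i + 1 + N := by omega
  rw [e1, e2, hper, hper] at hp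
  -- The funnel takes `p` to `q`, so one full turn leads from `p` back to `p`.
  have hpp : FibreReach (fun s => HasHamPath rΦ (X s)) L (fun i => st (c i)) (i + 1) N p p := by
    have := (hall p hp).trans (m := N - n) (u := p) (by rwa [Nat.add_right_comm i 1 n])
    rwa [Nat.add_sub_cancel' (by omega)] at this
  obtain ⟨l, hch, hnd, hlmem, hends⟩ := hpp.exists_list (r := r) (ext := ext) (N := N) hcinj
    (fun i j p q hp hq h => hinj _ (hcA i) _ (hcA j) p hp q hq h) (fun i p q => hr _ (hcA i) p q)
    (fun i p _ => hstep _ (hcA i) _ (hcA (i + 1)) (hcr i) p) le_rfl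
  obtain ⟨hhead, hlast⟩ := hends (by omega)
  -- Nonempty fibres give the closed list at least `N ≥ 3` entries. Adding `N * (i + 1)` moves an
  -- index beyond `i` without changing its base point.
  have hfib : ∀ j, ∃ w, w ∈ X (st (c j)) := fun j => by
    have hj : 0 < j + N := by omega
    obtain ⟨q, hq, -⟩ := exists_fibreReach (X := X) (v := fun i => st (c i)) (L := L)
      (HP := fun s => HasHamPath rΦ (X s)) (fun i p hp => hL _ _ p hp)
      (fun i p hp => hT _ _ (hctr i) p hp) i (j + N * (i + 1) - 1 - i) p hp
    have hle : i + 1 ≤ N * (i + 1) := Nat.le_mul_of_pos_left _ (by omega)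
    have hcj : ∀ a, c (j + N * a) = c j := fun a => by
      induction a with
      | zero => simp
      | succ a ih => rw [Nat.mul_succ, ← Nat.add_assoc, hper, ih]
    rw [show i + (j + N * (i + 1) - 1 - i) + 1 = j + N * (i + 1) by omega, hcj] at hq
    exact ⟨q, hL _ _ _ hq⟩
  refine HasHamCycle.of_list l ?_ hnd hch ?_ ?_
  · choose w hw using hfib
    have hsub : (List.map (fun m => ext (c (i + 1 + m)) (w (i + 1 + m))) (List.range N)) ⊆ l := by
      intro x hx
      obtain ⟨m, hm, rfl⟩ := List.mem_map.1 hx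
      exact (hlmem _).2 ⟨m, List.mem_range.1 hm, _, hw _, rfl⟩
    have hnd' : (List.map (fun m => ext (c (i + 1 + m)) (w (i + 1 + m))) (List.range N)).Nodup := by
      refine List.nodup_range.map_on ?_
      intro a ha b hb hab
      have ha := List.mem_range.1 ha
      have hb := List.mem_range.1 hb
      have := (hinj _ (hcA _) _ (hcA _) _ (hw _) _ (hw _) hab).1
      by_contra hne
      rcases Nat.lt_or_gt_of_ne hne with h | h
      · exact hcinj _ _ (by omega) (by omega) this
      · exact hcinj _ _ (by omega) (by omega) this.symm
    have := (hnd'.subperm hsub).length_le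
    simp only [List.length_map, List.length_range] at this
    omega
  · intro x
    rw [hmem, hlmem]
    constructor
    · rintro ⟨f, hf, p, hp, rfl⟩
      obtain ⟨n, rfl⟩ := (hcmem f).1 hf
      have hcj : ∀ a b, c (b + N * a) = c b := fun a b => by
        induction a with
        | zero => simp
        | succ a ih => rw [Nat.mul_succ, ← Nat.add_assoc, hper, ih]
      have hNi : i + 1 ≤ N * (i + 1) := Nat.le_mul_of_pos_left _ (by omega)
      have hc' : c (i + 1 + (n + N * (i + 1) - (i + 1)) % N) = c n := by
        rw [← hcj ((n + N * (i + 1) - (i + 1)) / N), Nat.add_assoc, Nat.mod_add_div,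
          Nat.add_sub_cancel' (by omega), hcj]
      refine ⟨(n + N * (i + 1) - (i + 1)) % N, Nat.mod_lt _ (by omega), p, ?_⟩
      rw [hc']
      exact ⟨hp, rfl⟩
    · rintro ⟨m, -, w, hw, rfl⟩
      exact ⟨_, hcA _, w, hw, rfl⟩
  · intro x hx y hy
    rw [hlast] at hx
    rw [hhead] at hy
    simp only [Option.mem_def, Option.some.injEq] at hx hy
    rw [← hx, ← hy, show i + 1 + N - 1 = i + N by omega, hper]
    exact hstep _ (hcA _) _ (hcA _) (hcr _) p

/-! ### Words on a path and finite searches -/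

/-- The `i`-th digit of `n` in base `k`; numbers encode words over `0, …, k - 1` in this way. -/
def wordDigit (k n i : ℕ) : ℕ := n / k ^ i % k

/-- The word of length `m` encoded by `n` is a proper coloring of a path, whose first vertex has
a neighbour of color `s.1` if `e₀` holds, and whose last one has a neighbour of color `s.2` if `e₁`
holds. -/
def isPathWord (k m : ℕ) (e₀ e₁ : Bool) (s : Fin k × Fin k) (n : ℕ) : Bool :=
  (!e₀ || wordDigit k n 0 != s.1) && (!e₁ || wordDigit k n (m - 1) != s.2) &&
    (List.range (m - 1)).all fun i => wordDigit k n i != wordDigit k n (i + 1)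

def pathWords (k m : ℕ) (e₀ e₁ : Bool) (s : Fin k × Fin k) : List ℕ :=
  (List.range (k ^ m)).filter (isPathWord k m e₀ e₁ s)

/-- The words over which the state may change from `s` to `t`. -/
def wordPorts (k m : ℕ) (e₀ e₁ : Bool) (s t : Fin k × Fin k) : List ℕ :=
  (pathWords k m e₀ e₁ s).filter fun p =>
    isPathWord k m e₀ e₁ t p && (e₀ || wordDigit k p 0 != s.1)

def wordAdj (k m j p q : ℕ) : Bool :=
  p != q && (List.range m).any fun i => (List.range m).all fun l =>
    wordDigit k p l == wordDigit k q l || l == i || (j == 2 && l == i + 1)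

/-- A search for a path from `p` to `q` through all `n` elements of the list `l`. -/
def pathSearch {α : Type*} [DecidableEq α] (adj : α → α → Bool) : ℕ → List α → α → α → Bool
  | 0, l, p, q => l.isEmpty && p == q
  | n + 1, l, p, q => p != q && l.any fun x => adj p x && pathSearch adj n (l.erase x) x q

theorem pathSearch_sound {α : Type*} [DecidableEq α] {adj : α → α → Bool} {n : ℕ} {l : List α}
    {p q : α} (h : pathSearch adj n l p q = true) :
    ∃ l', (p :: l').IsChain (fun x y => adj x y = true) ∧ l'.Perm l ∧
      (p :: l').getLast? = some q := by
  induction n generalizing l p with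
  | zero =>
    simp only [pathSearch, Bool.and_eq_true, List.isEmpty_iff, beq_iff_eq] at h
    exact ⟨[], by simp [h.1, h.2]⟩
  | succ n ih =>
    simp only [pathSearch, Bool.and_eq_true, List.any_eq_true] at h
    obtain ⟨-, x, hx, hpx, h⟩ := h
    obtain ⟨l', hch, hperm, hlast⟩ := ih h
    refine ⟨x :: l', ?_, (hperm.cons x).trans (List.perm_cons_erase hx).symm, ?_⟩
    · exact List.isChain_cons_cons.2 ⟨hpx, hch⟩
    · rw [List.getLast?_cons_cons, hlast]

/-- Two words of length `m` differ in one position, or in two consecutive ones if `j = 2`. -/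
def WordStep (k m j p q : ℕ) : Prop := wordAdj k m j p q = true ∧ p < k ^ m ∧ q < k ^ m

def wordPath (k m j : ℕ) (e₀ e₁ : Bool) (s : Fin k × Fin k) (p q : ℕ) : Bool :=
  (pathWords k m e₀ e₁ s).contains p &&
  pathSearch (wordAdj k m j) ((pathWords k m e₀ e₁ s).length - 1)
    ((pathWords k m e₀ e₁ s).erase p) p q

theorem wordPath_sound {k m j : ℕ} {e₀ e₁ : Bool} {s : Fin k × Fin k} {p q : ℕ}
    (h : wordPath k m j e₀ e₁ s p q = true) :
    HasHamPath (WordStep k m j) (pathWords k m e₀ e₁ s) p q := by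
  simp only [wordPath, Bool.and_eq_true, List.contains_iff_mem] at h
  obtain ⟨l, hch, hperm, hlast⟩ := pathSearch_sound h.2
  have hp := (hperm.cons p).trans (List.perm_cons_erase h.1).symm
  have hlt : ∀ x ∈ p :: l, x < k ^ m := fun x hx =>
    List.mem_range.1 (List.mem_filter.1 (hp.mem_iff.1 hx)).1
  refine ⟨p :: l, ?_, ?_, fun x => hp.mem_iff, rfl, hlast⟩
  · rw [List.isChain_iff_getElem] at hch ⊢
    exact fun i hi => ⟨hch i hi, hlt _ (List.getElem_mem _), hlt _ (List.getElem_mem _)⟩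
  rw [hp.nodup_iff]
  exact List.nodup_range.filter _

/-- The changes of state that occur in one step: both colors change together if `d` holds, and at
most one of them changes otherwise. -/
def stateStep (k : ℕ) (d : Bool) (s t : Fin k × Fin k) : Bool :=
  bif d then s.1 == s.2 && t.1 == t.2 else s.1 == t.1 || s.2 == t.2

/-- Keeps the traversal from getting stuck: whichever word is entered, some port towards the
prescribed next state can be the end of a Hamiltonian path. -/
def TotalCheck (k m j : ℕ) (e₀ e₁ d : Bool) : Prop :=
  ∀ a b a' b' : Fin k, stateStep k d (a, b) (a', b') = true →
    ((pathWords k m e₀ e₁ (a, b)).all fun p => (wordPorts k m e₀ e₁ (a, b) (a', b')).any fun q =>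
      wordPath k m j e₀ e₁ (a, b) p q) = true

/-- A funnel of one fibre. For a single new vertex the letter `a` can serve as `q`: it is never an
entering port, by the attaching edge or, for an isolated vertex, by the extra clause in `wordPorts`;
and `a ≠ c` lets it pass on to `c`. -/
def TripleCheck (k m j : ℕ) (e₀ e₁ : Bool) : Prop :=
  ∀ a b c : Fin k, a ≠ b → a ≠ c →
    ((wordPorts k m e₀ e₁ (b, b) (c, c)).any fun q => (wordPorts k m e₀ e₁ (a, a) (b, b)).all fun p =>
      wordPath k m j e₀ e₁ (b, b) p q) = true

/-- From state `t`, within `n` steps there is a port reached from each of the sets in `Rs`. -/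
def funnelSearch {S Φ : Type*} [DecidableEq Φ] (hp : S → Φ → Φ → Bool) (L : S → S → List Φ)
    (nb : S → List S) : ℕ → S → List (List Φ) → Bool
  | 0, _, _ => false
  | n + 1, t, Rs => (nb t).all fun u =>
      let Rs' := Rs.map fun R => (L t u).filter fun q => R.any fun p => hp t p q
      ((L t u).any fun q => Rs'.all fun R => R.contains q) || funnelSearch hp L nb n u Rs'

theorem funnelSearch_sound {S Φ : Type*} [DecidableEq Φ] {hp : S → Φ → Φ → Bool}
    {HP : S → Φ → Φ → Prop} (hHP : ∀ s p q, hp s p q = true → HP s p q)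
    {L : S → S → List Φ} {nb : S → List S} {v : ℕ → S} (hnb : ∀ n, v (n + 1) ∈ nb (v n))
    {n i : ℕ} {Rs : List (List Φ)} (h : funnelSearch hp L nb n (v i) Rs = true) :
    ∃ l ≤ n, ∃ q ∈ L (v (i + l - 1)) (v (i + l)), ∀ R ∈ Rs, ∃ p ∈ R, FibreReach HP L v i l p q := by
  induction n generalizing i Rs with
  | zero => simp [funnelSearch] at h
  | succ n ih =>
    simp only [funnelSearch, List.all_eq_true] at h
    have h := h _ (hnb i)
    rw [Bool.or_eq_true] at h
    rcases h with h | h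
    · simp only [List.any_eq_true, List.all_eq_true, List.mem_map, List.contains_iff_mem,
        forall_exists_index, and_imp, forall_apply_eq_imp_iff₂, List.mem_filter] at h
      obtain ⟨q, hq, h⟩ := h
      refine ⟨1, by omega, q, by simpa using hq, fun R hR => ?_⟩
      obtain ⟨-, p, hp, hpq⟩ := h R hR
      exact ⟨p, hp, q, hq, hHP _ _ _ hpq, rfl⟩
    · obtain ⟨l, hl, q, hq, h⟩ := ih h
      -- For `l = 0` the port already lies in every image set, so the fibre just crossed is the
      -- whole funnel.
      rcases Nat.eq_zero_or_pos l with rfl | hl0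
      · refine ⟨1, by omega, q, by simpa using hq, fun R hR => ?_⟩
        obtain ⟨p, hp, hpq⟩ := h _ (List.mem_map_of_mem hR)
        obtain rfl : p = q := hpq
        obtain ⟨hpL, hp⟩ := List.mem_filter.1 hp
        obtain ⟨u, hu, hup⟩ := List.any_eq_true.1 hp
        exact ⟨u, hu, p, hpL, hHP _ _ _ hup, rfl⟩
      · refine ⟨l + 1, by omega, q, ?_, fun R hR => ?_⟩
        · rwa [show i + (l + 1) - 1 = i + 1 + l - 1 by omega, show i + (l + 1) = i + 1 + l by omega]
        · obtain ⟨p, hp, hpq⟩ := h _ (List.mem_map_of_mem hR)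
          obtain ⟨hpL, hp⟩ := List.mem_filter.1 hp
          obtain ⟨u, hu, hup⟩ := List.any_eq_true.1 hp
          exact ⟨u, hu, p, hpL, hHP _ _ _ hup, hpq⟩

def stateNext (k : ℕ) (s : Fin k × Fin k) : List (Fin k × Fin k) :=
  (List.finRange k).map (fun a => (a, s.2)) ++ (List.finRange k).map (fun b => (s.1, b))

theorem mem_stateNext {k : ℕ} {s t : Fin k × Fin k} (h : stateStep k false s t = true) :
    t ∈ stateNext k s := by
  obtain ⟨a, b⟩ := s
  obtain ⟨c, e⟩ := t
  simp only [stateStep, cond_false, Bool.or_eq_true, beq_iff_eq] at h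
  simp only [stateNext, List.mem_append, List.mem_map, List.mem_finRange, true_and]
  rcases h with rfl | rfl
  · exact Or.inr ⟨e, rfl⟩
  · exact Or.inl ⟨c, rfl⟩

/-- Each entering port starts as its own singleton, so a port common to all image sets is reached
from every one of them, whatever states follow. -/
def windowCheck (k m j n : ℕ) (s t : Fin k × Fin k) : Bool :=
  funnelSearch (wordPath k m j true true) (wordPorts k m true true) (stateNext k) n t
    ((wordPorts k m true true s t).map fun p => [p])

/-! ### Patterns in periodic state sequences -/

theorem eq_of_periodic_of_forall_ge {S : Type*} {v : ℕ → S} {N i : ℕ} (hN : 0 < N)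
    (hper : ∀ n, v (n + N) = v n) (P : S → Prop) (h : ∀ n, P (v (i + n))) (n : ℕ) : P (v n) := by
  have hc : ∀ a, v (n + N * a) = v n := fun a => by
    induction a with
    | zero => simp
    | succ a ih => rw [Nat.mul_succ, ← Nat.add_assoc, hper, ih]
  have hle : i ≤ N * i := Nat.le_mul_of_pos_left _ hN
  have := h (n + N * i - i)
  rwa [Nat.add_sub_cancel' (by omega), hc] at this

/-- Otherwise every change is undone at the next step, so after some change the sequence alternates
between two states, and by periodicity no third state occurs. -/
theorem exists_triple {S : Type*} {v : ℕ → S} {N : ℕ} (hN : 0 < N) (hper : ∀ n, v (n + N) = v n)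
    (h3 : ∀ s t, ∃ n, v n ≠ s ∧ v n ≠ t) : ∃ i, v i ≠ v (i + 1) ∧ v i ≠ v (i + 2) := by
  by_contra! hcon
  obtain ⟨i, hi⟩ : ∃ i, v i ≠ v (i + 1) := by
    by_contra! h
    obtain ⟨n, hn, -⟩ := h3 (v 0) (v 0)
    have hall : ∀ n, v n = v 0 := fun n => by
      induction n with
      | zero => rfl
      | succ n ih => rw [← h, ih]
    exact hn (hall n)
  have hall : ∀ n, (v (i + n) = v i ∧ v (i + n + 1) = v (i + 1)) ∨
      (v (i + n) = v (i + 1) ∧ v (i + n + 1) = v i) := fun n => by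
    induction n with
    | zero => exact Or.inl ⟨rfl, rfl⟩
    | succ n ih =>
      have := hcon (i + n)
      rw [show i + (n + 1) = i + n + 1 by omega]
      rcases ih with ⟨h1, h2⟩ | ⟨h1, h2⟩
      · exact Or.inr ⟨h2, by rw [← h1]; exact (this (by rw [h1, h2]; exact hi)).symm⟩
      · exact Or.inl ⟨h2, by rw [← h1]; exact (this (by rw [h1, h2]; exact hi.symm)).symm⟩
  obtain ⟨n, h1, h2⟩ := h3 (v i) (v (i + 1))
  refine eq_of_periodic_of_forall_ge (i := i) hN hper (fun s => ¬(s ≠ v i ∧ s ≠ v (i + 1)))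
    (fun n => ?_) n ⟨h1, h2⟩
  rcases hall n with ⟨h, -⟩ | ⟨h, -⟩ <;> simp [h]

theorem eq_of_stateStep_of_diag {k : ℕ} {s t : Fin k × Fin k} (h : stateStep k false s t = true)
    (hs : s.1 = s.2) (ht : t.1 = t.2) : s = t := by
  obtain ⟨a, b⟩ := s
  obtain ⟨c, e⟩ := t
  obtain rfl : a = b := hs
  obtain rfl : c = e := ht
  simpa [stateStep] using h

/-- If every change landed on the diagonal, the sequence would stay there after one change, hence
always by periodicity. But a step altering at most one entry cannot join two distinct diagonal
states. -/
theorem exists_change_to_offDiag {k : ℕ} {v : ℕ → Fin k × Fin k} {N : ℕ} (hN : 0 < N)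
    (hper : ∀ n, v (n + N) = v n) (hstep : ∀ n, stateStep k false (v n) (v (n + 1)) = true)
    (hne : ∀ s, ∃ n, v n ≠ s) : ∃ i, v i ≠ v (i + 1) ∧ (v (i + 1)).1 ≠ (v (i + 1)).2 := by
  by_contra! hcon
  obtain ⟨i, hi⟩ : ∃ i, v i ≠ v (i + 1) := by
    by_contra! h
    obtain ⟨n, hn⟩ := hne (v 0)
    have hall : ∀ n, v n = v 0 := fun n => by
      induction n with
      | zero => rfl
      | succ n ih => rw [← h, ih]
    exact hn (hall n)
  have hall : ∀ n, (v (i + 1 + n)).1 = (v (i + 1 + n)).2 := fun n => by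
    induction n with
    | zero => exact hcon i hi
    | succ n ih =>
      rw [← Nat.add_assoc]
      by_cases h : v (i + 1 + n) = v (i + 1 + n + 1)
      · rw [← h]; exact ih
      · exact hcon _ h
  have hdiag := eq_of_periodic_of_forall_ge hN hper (fun s => s.1 = s.2) hall
  exact hi (eq_of_stateStep_of_diag (hstep i) (hdiag _) (hdiag _))

/-- A diagonal that is never left would contain the whole periodic sequence, which would then be
constant. -/
theorem exists_change_from_diag {k : ℕ} {v : ℕ → Fin k × Fin k} {N : ℕ} (hN : 0 < N)
    (hper : ∀ n, v (n + N) = v n) (hstep : ∀ n, stateStep k false (v n) (v (n + 1)) = true)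
    (hne : ∀ s, ∃ n, v n ≠ s) (hdiag : ∃ n, (v n).1 = (v n).2) :
    ∃ i, (v i).1 = (v i).2 ∧ (v (i + 1)).1 ≠ (v (i + 1)).2 := by
  by_contra! hcon
  obtain ⟨i, hi⟩ := hdiag
  have hall : ∀ n, (v (i + n)).1 = (v (i + n)).2 := fun n => by
    induction n with
    | zero => exact hi
    | succ n ih => exact hcon _ ih
  have hdiag := eq_of_periodic_of_forall_ge hN hper (fun s => s.1 = s.2) hall
  obtain ⟨n, hn⟩ := hne (v 0)
  have hconst : ∀ n, v n = v 0 := fun n => by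
    induction n with
    | zero => rfl
    | succ n ih => rw [← ih]; exact (eq_of_stateStep_of_diag (hstep n) (hdiag _) (hdiag _)).symm
  exact hn (hconst n)

/-! ### Colorings of a part and attachment of a path -/

section coloringsOn

variable {W : Type*}

/-- The proper colorings of the subgraph of `H` induced on `A`, extended by `0` outside `A`. -/
def coloringsOn (H : SimpleGraph W) (k : ℕ) [NeZero k] (A : Set W) : Set (W → Fin k) :=
  {f | (∀ v, v ∉ A → f v = 0) ∧ ∀ u ∈ A, ∀ v ∈ A, H.Adj u v → f u ≠ f v}

/-- `f` and `g` are distinct, but differ only on a vertex, or on the ends of an edge if `j = 2`. -/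
def LocalStep (H : SimpleGraph W) (j : ℕ) {κ : Type*} (f g : W → κ) : Prop :=
  f ≠ g ∧ ∃ u v, (u = v ∨ j = 2 ∧ H.Adj u v) ∧ ∀ w, f w ≠ g w → w = u ∨ w = v

/-- The vertices `ι 0, …, ι (m - 1)` outside `A` form a path, which is attached to `A` by an edge
from its first vertex to `x` if `e₀` holds and an edge from its last vertex to `y` if `e₁` holds. -/
structure PathAttached (H : SimpleGraph W) (A : Set W) {m : ℕ} (ι : Fin m → W) (e₀ e₁ : Bool)
    (x y : W) : Prop where
  pos : 0 < m
  inj : Function.Injective ι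
  notMem : ∀ i, ι i ∉ A
  left_mem : x ∈ A
  right_mem : y ∈ A
  adj_iff : ∀ i j, H.Adj (ι i) (ι j) ↔ (i : ℕ) + 1 = j ∨ (j : ℕ) + 1 = i
  adj_mem_iff : ∀ i, ∀ w ∈ A, H.Adj (ι i) w ↔
    e₀ = true ∧ (i : ℕ) = 0 ∧ w = x ∨ e₁ = true ∧ (i : ℕ) + 1 = m ∧ w = y

/-- Recolor the vertices `ι i` by the word encoded by `n`. -/
noncomputable def paint {k m : ℕ} [NeZero k] (ι : Fin m → W) (f : W → Fin k) (n : ℕ) : W → Fin k :=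
  Function.extend ι (fun i => Fin.ofNat k (n / k ^ (i : ℕ))) f

theorem mem_pathWords {k m n : ℕ} {e₀ e₁ : Bool} {s : Fin k × Fin k} :
    n ∈ pathWords k m e₀ e₁ s ↔ n < k ^ m ∧ (e₀ = true → wordDigit k n 0 ≠ s.1) ∧
      (e₁ = true → wordDigit k n (m - 1) ≠ s.2) ∧
      ∀ i, i + 1 < m → wordDigit k n i ≠ wordDigit k n (i + 1) := by
  simp only [pathWords, List.mem_filter, List.mem_range, isPathWord, Bool.and_eq_true,
    Bool.or_eq_true, Bool.not_eq_true', bne_iff_ne, List.all_eq_true, Nat.lt_sub_iff_add_lt,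
    ← and_assoc]
  cases e₀ <;> cases e₁ <;> simp

section paint

variable {k m : ℕ} [NeZero k] {H : SimpleGraph W} {A : Set W} {ι : Fin m → W} {e₀ e₁ : Bool}
  {x y : W}

theorem PathAttached.paint_apply (h : PathAttached H A ι e₀ e₁ x y) (f : W → Fin k) (n : ℕ)
    (i : Fin m) : (paint ι f n (ι i) : ℕ) = wordDigit k n i := by
  rw [paint, h.inj.extend_apply]
  rfl

theorem PathAttached.paint_apply_mem (h : PathAttached H A ι e₀ e₁ x y) (f : W → Fin k) (n : ℕ)
    {w : W} (hw : w ∈ A) : paint ι f n w = f w := by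
  rw [paint, Function.extend_apply']
  rintro ⟨i, rfl⟩
  exact h.notMem i hw

theorem paint_apply_of_notMem_range (ι : Fin m → W) (f : W → Fin k) (n : ℕ)
    {w : W} (hw : w ∉ Set.range ι) : paint ι f n w = f w := by
  rw [paint, Function.extend_apply']
  exact hw

theorem PathAttached.paint_ne_iff (h : PathAttached H A ι e₀ e₁ x y) (f : W → Fin k) (n : ℕ)
    (i j : Fin m) :
    paint ι f n (ι i) ≠ paint ι f n (ι j) ↔ wordDigit k n i ≠ wordDigit k n j := by
  rw [Ne, Fin.ext_iff, h.paint_apply, h.paint_apply]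

theorem PathAttached.paint_ne_iff_mem (h : PathAttached H A ι e₀ e₁ x y) (f : W → Fin k) (n : ℕ)
    (i : Fin m) {w : W} (hw : w ∈ A) :
    paint ι f n (ι i) ≠ paint ι f n w ↔ wordDigit k n i ≠ f w := by
  rw [Ne, Fin.ext_iff, h.paint_apply, h.paint_apply_mem f n hw]

theorem PathAttached.paint_mem (h : PathAttached H A ι e₀ e₁ x y) {f : W → Fin k}
    (hf : f ∈ coloringsOn H k A) {n : ℕ} (hn : n ∈ pathWords k m e₀ e₁ (f x, f y)) :
    paint ι f n ∈ coloringsOn H k (A ∪ Set.range ι) := by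
  obtain ⟨-, h0, h1, hpath⟩ := mem_pathWords.1 hn
  have hnew : ∀ i j, H.Adj (ι i) (ι j) → paint ι f n (ι i) ≠ paint ι f n (ι j) := by
    intro i j hij
    rw [h.paint_ne_iff]
    rcases (h.adj_iff i j).1 hij with h | h
    · rw [← h]; exact hpath i (by omega)
    · rw [← h]; exact (hpath j (by omega)).symm
  have hmix : ∀ i, ∀ w ∈ A, H.Adj (ι i) w → paint ι f n (ι i) ≠ paint ι f n w := by
    intro i w hw hiw
    rw [h.paint_ne_iff_mem _ _ _ hw]
    rcases (h.adj_mem_iff i w hw).1 hiw with ⟨he, hi, rfl⟩ | ⟨he, hi, rfl⟩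
    · rw [hi]; exact h0 he
    · rw [show (i : ℕ) = m - 1 by omega]; exact h1 he
  constructor
  · intro v hv
    rw [Set.mem_union, not_or] at hv
    rw [paint_apply_of_notMem_range _ _ _ hv.2]
    exact hf.1 v hv.1
  · rintro u (hu | ⟨i, rfl⟩) v (hv | ⟨j, rfl⟩) huv
    · rw [h.paint_apply_mem f n hu, h.paint_apply_mem f n hv]
      exact hf.2 u hu v hv huv
    · exact (hmix j u hu huv.symm).symm
    · exact hmix i v hv huv
    · exact hnew i j huv

/-- The fibration itself: restricting to `A`, with `0` elsewhere, and reading the colors along the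
path in base `k` undoes `paint`. -/
theorem PathAttached.mem_coloringsOn_iff (h : PathAttached H A ι e₀ e₁ x y) (g : W → Fin k) :
    g ∈ coloringsOn H k (A ∪ Set.range ι) ↔ ∃ f ∈ coloringsOn H k A,
      ∃ n ∈ pathWords k m e₀ e₁ (f x, f y), paint ι f n = g := by
  classical
  refine ⟨fun hg => ?_, fun ⟨f, hf, n, hn, he⟩ => he ▸ h.paint_mem hf hn⟩
  have hdig : ∀ i : Fin m, wordDigit k (finFunctionFinEquiv fun i => g (ι i)) i = g (ι i) :=
    fun i => congrArg Fin.val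
      (congrFun (finFunctionFinEquiv.symm_apply_apply fun i => g (ι i)) i)
  set n : ℕ := ((finFunctionFinEquiv fun i => g (ι i) : Fin (k ^ m)) : ℕ) with hn
  set f : W → Fin k := fun w => if w ∈ A then g w else 0 with hf
  have hfA : ∀ w ∈ A, f w = g w := fun w hw => if_pos hw
  have hpg : paint ι f n = g := by
    funext w
    by_cases hw : w ∈ Set.range ι
    · obtain ⟨i, rfl⟩ := hw
      rw [Fin.ext_iff, h.paint_apply, hdig]
    · rw [paint_apply_of_notMem_range _ _ _ hw]
      by_cases hwA : w ∈ A
      · exact hfA w hwA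
      · rw [hg.1 w (by simp [hw, hwA])]
        exact if_neg hwA
  have hpos := h.pos
  refine ⟨f, ⟨fun v hv => if_neg hv, fun u hu v hv huv => ?_⟩, n, ?_, hpg⟩
  · rw [hfA u hu, hfA v hv]
    exact hg.2 u (Or.inl hu) v (Or.inl hv) huv
  · refine mem_pathWords.2 ⟨(finFunctionFinEquiv _).2, fun he => ?_, fun he => ?_, fun i hi => ?_⟩
    · have hadj : H.Adj (ι ⟨0, hpos⟩) x := (h.adj_mem_iff _ _ h.left_mem).2 (Or.inl ⟨he, rfl, rfl⟩)
      have := hg.2 _ (Or.inr ⟨_, rfl⟩) _ (Or.inl h.left_mem) hadj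
      rwa [← hpg, h.paint_ne_iff_mem _ _ _ h.left_mem] at this
    · have hadj : H.Adj (ι ⟨m - 1, by omega⟩) y :=
        (h.adj_mem_iff _ _ h.right_mem).2 (Or.inr ⟨he, by simp; omega, rfl⟩)
      have := hg.2 _ (Or.inr ⟨_, rfl⟩) _ (Or.inl h.right_mem) hadj
      rwa [← hpg, h.paint_ne_iff_mem _ _ _ h.right_mem] at this
    · have hadj : H.Adj (ι ⟨i, by omega⟩) (ι ⟨i + 1, hi⟩) := (h.adj_iff _ _).2 (Or.inl rfl)
      have := hg.2 _ (Or.inr ⟨_, rfl⟩) _ (Or.inr ⟨_, rfl⟩) hadj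
      rwa [← hpg, h.paint_ne_iff] at this

theorem PathAttached.paint_inj (h : PathAttached H A ι e₀ e₁ x y) {f g : W → Fin k}
    (hf : f ∈ coloringsOn H k A) (hg : g ∈ coloringsOn H k A) {n n' : ℕ} (hn : n < k ^ m)
    (hn' : n' < k ^ m) (he : paint ι f n = paint ι g n') : f = g ∧ n = n' := by
  constructor
  · funext w
    by_cases hw : w ∈ A
    · rw [← h.paint_apply_mem f n hw, he, h.paint_apply_mem g n' hw]
    · rw [hf.1 w hw, hg.1 w hw]
  · have : finFunctionFinEquiv.symm (⟨n, hn⟩ : Fin (k ^ m)) =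
        finFunctionFinEquiv.symm ⟨n', hn'⟩ := by
      funext i
      rw [Fin.ext_iff]
      change wordDigit k n i = wordDigit k n' i
      rw [← h.paint_apply f, he, h.paint_apply g]
    simpa using this

theorem PathAttached.localStep_paint (h : PathAttached H A ι e₀ e₁ x y) {j : ℕ} (f : W → Fin k)
    {p q : ℕ} (hpq : wordAdj k m j p q = true) (hp : p < k ^ m) (hq : q < k ^ m)
    (hf : f ∈ coloringsOn H k A) :
    LocalStep H j (paint ι f p) (paint ι f q) := by
  simp only [wordAdj, Bool.and_eq_true, bne_iff_ne, List.any_eq_true, List.mem_range,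
    List.all_eq_true, Bool.or_eq_true, beq_iff_eq] at hpq
  obtain ⟨hne, i, hi, hall⟩ := hpq
  refine ⟨fun he => hne (h.paint_inj hf hf hp hq he).2, ι ⟨i, hi⟩, ?_⟩
  have key : ∀ w, paint ι f p w ≠ paint ι f q w → ∃ l : Fin m, w = ι l ∧
      ((l : ℕ) = i ∨ j = 2 ∧ (l : ℕ) = i + 1) := by
    intro w hw
    by_cases hr : w ∈ Set.range ι
    · obtain ⟨l, rfl⟩ := hr
      refine ⟨l, rfl, ?_⟩
      rw [Ne, Fin.ext_iff, h.paint_apply, h.paint_apply] at hw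
      rcases hall l l.2 with (h | h) | h
      · exact absurd h hw
      · exact Or.inl h
      · exact Or.inr h
    · rw [paint_apply_of_notMem_range _ _ _ hr, paint_apply_of_notMem_range _ _ _ hr] at hw
      exact absurd rfl hw
  by_cases hj : j = 2 ∧ i + 1 < m
  · refine ⟨ι ⟨i + 1, hj.2⟩, Or.inr ⟨hj.1, (h.adj_iff _ _).2 (Or.inl rfl)⟩, fun w hw => ?_⟩
    obtain ⟨l, rfl, hl | hl⟩ := key w hw
    · exact Or.inl (congrArg ι (Fin.ext hl))
    · exact Or.inr (congrArg ι (Fin.ext hl.2))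
  · refine ⟨ι ⟨i, hi⟩, Or.inl rfl, fun w hw => ?_⟩
    obtain ⟨l, rfl, hl | hl⟩ := key w hw
    · exact Or.inl (congrArg ι (Fin.ext hl))
    · exact absurd ⟨hl.1, by omega⟩ hj

theorem PathAttached.localStep_paint_of_localStep (h : PathAttached H A ι e₀ e₁ x y) {j : ℕ}
    {f g : W → Fin k} (hf : f ∈ coloringsOn H k A) (hg : g ∈ coloringsOn H k A)
    (hfg : LocalStep H j f g) (p : ℕ) : LocalStep H j (paint ι f p) (paint ι g p) := by
  obtain ⟨hne, u, v, huv, hw⟩ := hfg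
  refine ⟨fun he => hne ?_, u, v, huv, fun w hne' => hw w fun he => hne' ?_⟩
  · funext w
    by_cases hwA : w ∈ A
    · rw [← h.paint_apply_mem f p hwA, he, h.paint_apply_mem g p hwA]
    · rw [hf.1 w hwA, hg.1 w hwA]
  · by_cases hr : w ∈ Set.range ι
    · obtain ⟨l, rfl⟩ := hr
      rw [Fin.ext_iff, h.paint_apply, h.paint_apply]
    · rw [paint_apply_of_notMem_range _ _ _ hr, paint_apply_of_notMem_range _ _ _ hr, he]

end paint

/-- Two distinct vertices are both recolored only if they are the ends of the recolored edge. -/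
theorem LocalStep.stateStep {k : ℕ} {H : SimpleGraph W} {j : ℕ} {f g : W → Fin k}
    (h : LocalStep H j f g) {x y : W} (hxy : x ≠ y) (hadj : ¬(j = 2 ∧ H.Adj x y)) :
    stateStep k false (f x, f y) (g x, g y) = true := by
  obtain ⟨-, u, v, huv, hw⟩ := h
  simp only [_root_.stateStep, cond_false, Bool.or_eq_true, beq_iff_eq]
  by_contra! hne
  rcases hw x hne.1 with rfl | rfl <;> rcases hw y hne.2 with rfl | rfl
  · exact hxy rfl
  · exact huv.elim hxy hadj
  · exact huv.elim (fun h => hxy h.symm) fun h => hadj ⟨h.1, h.2.symm⟩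
  · exact hxy rfl

theorem exists_apply_eq_of_mem_coloringsOn {k : ℕ} [NeZero k] {H : SimpleGraph W} {A : Set W}
    (hne : (coloringsOn H k A).Nonempty) {x : W} (hx : x ∈ A) (a : Fin k) :
    ∃ f ∈ coloringsOn H k A, f x = a := by
  classical
  obtain ⟨f, hf⟩ := hne
  refine ⟨fun w => if w ∈ A then Equiv.swap (f x) a (f w) else 0,
    ⟨fun v hv => if_neg hv, fun u hu v hv huv => ?_⟩, by simp [hx]⟩
  simpa [hu, hv] using hf.2 u hu v hv huv

theorem HasHamCycle.nonempty {α : Type*} {r : α → α → Prop} {A : Set α} (h : HasHamCycle r A) :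
    A.Nonempty := by
  obtain ⟨N, c, -, -, -, hc, -⟩ := h
  exact ⟨c 0, (hc _).2 ⟨0, rfl⟩⟩

/-- Attaching a path keeps a Hamiltonian cycle of colorings, if a funnel can always be found. -/
theorem PathAttached.hasHamCycle {k m j : ℕ} [NeZero k] {H : SimpleGraph W} {A : Set W}
    {ι : Fin m → W} {e₀ e₁ : Bool} {x y : W} (h : PathAttached H A ι e₀ e₁ x y) (d : Bool)
    (hd : if d then x = y else x ≠ y ∧ ¬(j = 2 ∧ H.Adj x y))
    (hA : HasHamCycle (LocalStep H j) (coloringsOn H k A)) (hT : TotalCheck k m j e₀ e₁ d)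
    (hclose : ∀ (v : ℕ → Fin k × Fin k) (N : ℕ), 0 < N → (∀ n, v (n + N) = v n) →
      (∀ n, stateStep k d (v n) (v (n + 1)) = true) →
      (∀ f ∈ coloringsOn H k A, ∃ n, v n = (f x, f y)) →
      ∃ i n, n ≤ 3 ∧ ∃ q ∈ wordPorts k m e₀ e₁ (v (i + n)) (v (i + n + 1)),
        ∀ p ∈ wordPorts k m e₀ e₁ (v i) (v (i + 1)),
          FibreReach (fun s => HasHamPath (WordStep k m j) (pathWords k m e₀ e₁ s))
            (wordPorts k m e₀ e₁) v (i + 1) n p q) :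
    HasHamCycle (LocalStep H j) (coloringsOn H k (A ∪ Set.range ι)) := by
  have hlt : ∀ {s p}, p ∈ pathWords k m e₀ e₁ s → p < k ^ m := fun hp => (mem_pathWords.1 hp).1
  refine hA.lift (st := fun f => (f x, f y)) (ext := paint ι) (X := pathWords k m e₀ e₁)
    (rΦ := WordStep k m j) (L := wordPorts k m e₀ e₁) (tr := fun s t => stateStep k d s t = true)
    ?_ h.mem_coloringsOn_iff ?_ ?_ ?_ ?_ ?_ hclose
  · exact fun f hf g hg p hp q hq he => h.paint_inj hf hg (hlt hp) (hlt hq) he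
  · exact fun f hf p q hpq => h.localStep_paint f hpq.1 hpq.2.1 hpq.2.2 hf
  · exact fun f hf g hg hfg p => h.localStep_paint_of_localStep hf hg hfg p
  · intro f _ g _ hfg
    cases d with
    | true =>
      obtain rfl : x = y := by simpa using hd
      simp [stateStep]
    | false =>
      have hd : x ≠ y ∧ ¬(j = 2 ∧ H.Adj x y) := by simpa using hd
      exact hfg.stateStep hd.1 hd.2
  · intro s t p hp
    simp only [wordPorts, List.mem_filter, Bool.and_eq_true] at hp
    exact List.mem_filter.2 ⟨List.mem_range.2 (hlt hp.1), hp.2.1⟩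
  · intro s t hst p hp
    have := hT s.1 s.2 t.1 t.2 hst
    rw [List.all_eq_true] at this
    obtain ⟨q, hq, hpq⟩ := List.any_eq_true.1 (this p hp)
    exact ⟨q, hq, wordPath_sound hpq⟩

/-- Permuting colors shows that every color occurs at `x`; one of at least three colors differs from
the first entries of both `s` and `t`. -/
theorem exists_state_ne {k : ℕ} [NeZero k] {H : SimpleGraph W} {A : Set W} (hk : 3 ≤ k)
    (hA : (coloringsOn H k A).Nonempty) {x y : W} (hx : x ∈ A) {v : ℕ → Fin k × Fin k}
    (hv : ∀ f ∈ coloringsOn H k A, ∃ n, v n = (f x, f y)) (s t : Fin k × Fin k) :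
    ∃ n, v n ≠ s ∧ v n ≠ t := by
  obtain ⟨a, ha⟩ : ∃ a, a ∉ ({s.1, t.1} : Finset (Fin k)) := by
    by_contra! h
    have h1 := Finset.card_le_card (fun a _ => h a : Finset.univ ⊆ ({s.1, t.1} : Finset (Fin k)))
    have h2 := Finset.card_le_two (a := s.1) (b := t.1)
    rw [Finset.card_univ, Fintype.card_fin] at h1
    omega
  simp only [Finset.mem_insert, Finset.mem_singleton, not_or] at ha
  obtain ⟨f, hf, rfl⟩ := exists_apply_eq_of_mem_coloringsOn hA hx a
  obtain ⟨n, hn⟩ := hv f hf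
  exact ⟨n, fun h => ha.1 (by rw [← h, hn]), fun h => ha.2 (by rw [← h, hn])⟩

theorem PathAttached.hasHamCycle_of_tripleCheck {k m j : ℕ} [NeZero k] (hk : 3 ≤ k)
    {H : SimpleGraph W} {A : Set W} {ι : Fin m → W} {e₀ e₁ : Bool} {x : W}
    (h : PathAttached H A ι e₀ e₁ x x) (hA : HasHamCycle (LocalStep H j) (coloringsOn H k A))
    (hT : TotalCheck k m j e₀ e₁ true) (hc : TripleCheck k m j e₀ e₁) :
    HasHamCycle (LocalStep H j) (coloringsOn H k (A ∪ Set.range ι)) := by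
  refine h.hasHamCycle true (by simp) hA hT fun v N hN hper hstep hv => ?_
  obtain ⟨i, h1, h2⟩ := exists_triple hN hper (exists_state_ne hk hA.nonempty h.left_mem hv)
  have hdiag : ∀ n, v n = ((v n).1, (v n).1) := fun n => by
    have := hstep n
    simp only [stateStep, cond_true, Bool.and_eq_true, beq_iff_eq] at this
    exact Prod.ext rfl this.1.symm
  have := hc (v i).1 (v (i + 1)).1 (v (i + 2)).1
    (fun h => h1 (by rw [hdiag i, hdiag (i + 1), h])) (fun h => h2 (by rw [hdiag i, hdiag (i + 2), h]))
  rw [← hdiag, ← hdiag, ← hdiag] at this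
  obtain ⟨q, hq, hall⟩ := List.any_eq_true.1 this
  rw [List.all_eq_true] at hall
  exact ⟨i, 1, by omega, q, hq, fun p hp => ⟨q, hq, wordPath_sound (hall p hp), rfl⟩⟩

theorem exists_funnel_of_windowCheck {k m j n : ℕ} (hn : n ≤ 3) {v : ℕ → Fin k × Fin k}
    (hstep : ∀ n, stateStep k false (v n) (v (n + 1)) = true) {i : ℕ}
    (h : windowCheck k m j n (v i) (v (i + 1)) = true) :
    ∃ i n, n ≤ 3 ∧ ∃ q ∈ wordPorts k m true true (v (i + n)) (v (i + n + 1)),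
        ∀ p ∈ wordPorts k m true true (v i) (v (i + 1)),
          FibreReach (fun s => HasHamPath (WordStep k m j) (pathWords k m true true s))
            (wordPorts k m true true) v (i + 1) n p q := by
  obtain ⟨l, hl, q, hq, hall⟩ := funnelSearch_sound
    (HP := fun s => HasHamPath (WordStep k m j) (pathWords k m true true s))
    (fun s p q => wordPath_sound) (fun n => mem_stateNext (hstep n)) h
  refine ⟨i, l, hl.trans hn, q, ?_, fun p hp => ?_⟩
  · rwa [show i + 1 + l - 1 = i + l by omega, Nat.add_right_comm] at hq
  · obtain ⟨p', hp', hpq⟩ := hall [p] (List.mem_map_of_mem hp)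
    obtain rfl := List.mem_singleton.1 hp'
    exact hpq

/-! ### Connectivity -/

/-- The relation `r` connects the nonempty set `A`. -/
def ConnectsOn {α : Type*} (r : α → α → Prop) (A : Set α) : Prop :=
  A.Nonempty ∧ ∀ f ∈ A, ∀ g ∈ A, Relation.ReflTransGen (fun a b => a ∈ A ∧ b ∈ A ∧ r a b) f g

/-- The first half gives each fibre a centre adjacent to all its other words; the second gives a
port for each base step. -/
def ConnectCheck (k m j : ℕ) (e₀ e₁ d : Bool) : Prop :=
  ∀ a b a' b' : Fin k, stateStep k d (a, b) (a', b') = true →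
    (((pathWords k m e₀ e₁ (a, b)).any fun q => (pathWords k m e₀ e₁ (a, b)).all fun p =>
      p == q || (wordAdj k m j p q && wordAdj k m j q p)) &&
    (wordPorts k m e₀ e₁ (a, b) (a', b')).any fun _ => true) = true

theorem PathAttached.connectsOn {k m j : ℕ} [NeZero k] {H : SimpleGraph W} {A : Set W}
    {ι : Fin m → W} {e₀ e₁ : Bool} {x y : W} (h : PathAttached H A ι e₀ e₁ x y) (d : Bool)
    (hd : if d then x = y else x ≠ y ∧ ¬(j = 2 ∧ H.Adj x y))
    (hA : ConnectsOn (LocalStep H j) (coloringsOn H k A)) (hc : ConnectCheck k m j e₀ e₁ d) :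
    ConnectsOn (LocalStep H j) (coloringsOn H k (A ∪ Set.range ι)) := by
  have hself : ∀ f : W → Fin k, _root_.stateStep k d (f x, f y) (f x, f y) = true := by
    intro f
    cases d with
    | true =>
      obtain rfl : x = y := by simpa using hd
      simp [stateStep]
    | false => simp [stateStep]
  have htr : ∀ f g : W → Fin k, LocalStep H j f g →
      _root_.stateStep k d (f x, f y) (g x, g y) = true := by
    intro f g hfg
    cases d with
    | true =>
      obtain rfl : x = y := by simpa using hd
      simp [stateStep]
    | false =>
      have hd : x ≠ y ∧ ¬(j = 2 ∧ H.Adj x y) := by simpa using hd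
      exact hfg.stateStep hd.1 hd.2
  have hlt : ∀ {s p}, p ∈ pathWords k m e₀ e₁ s → p < k ^ m := fun hp => (mem_pathWords.1 hp).1
  have hfib : ∀ f ∈ coloringsOn H k A, ∀ p ∈ pathWords k m e₀ e₁ (f x, f y),
      ∀ q ∈ pathWords k m e₀ e₁ (f x, f y), Relation.ReflTransGen
        (fun a b => a ∈ coloringsOn H k (A ∪ Set.range ι) ∧
          b ∈ coloringsOn H k (A ∪ Set.range ι) ∧ LocalStep H j a b) (paint ι f p) (paint ι f q) := by
    intro f hf p hp q hq
    have := hc _ _ _ _ (hself f)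
    rw [Bool.and_eq_true, List.any_eq_true] at this
    obtain ⟨⟨u, hu, hall⟩, -⟩ := this
    simp only [List.all_eq_true, Bool.or_eq_true, beq_iff_eq, Bool.and_eq_true] at hall
    refine Relation.ReflTransGen.trans (b := paint ι f u) ?_ ?_
    · rcases hall p hp with rfl | hpu
      · exact Relation.ReflTransGen.refl
      · exact Relation.ReflTransGen.single ⟨h.paint_mem hf hp, h.paint_mem hf hu,
          h.localStep_paint f hpu.1 (hlt hp) (hlt hu) hf⟩
    · rcases hall q hq with rfl | hqu
      · exact Relation.ReflTransGen.refl
      · exact Relation.ReflTransGen.single ⟨h.paint_mem hf hu, h.paint_mem hf hq,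
          h.localStep_paint f hqu.2 (hlt hu) (hlt hq) hf⟩
  constructor
  · obtain ⟨f, hf⟩ := hA.1
    have := hc _ _ _ _ (hself f)
    rw [Bool.and_eq_true, List.any_eq_true] at this
    obtain ⟨⟨u, hu, -⟩, -⟩ := this
    exact ⟨_, h.paint_mem hf hu⟩
  · intro f' hf' g' hg'
    obtain ⟨f, hf, p, hp, rfl⟩ := (h.mem_coloringsOn_iff f').1 hf'
    obtain ⟨g, hg, q, hq, rfl⟩ := (h.mem_coloringsOn_iff g').1 hg'
    have hfg := hA.2 f hf g hg
    clear hf'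
    induction hfg using Relation.ReflTransGen.head_induction_on generalizing p with
    | refl => exact hfib g hg p hp q hq
    | @head a b hab _ ih =>
      have := hc _ _ _ _ (htr _ _ hab.2.2)
      rw [Bool.and_eq_true, List.any_eq_true, List.any_eq_true] at this
      obtain ⟨-, u, hu, -⟩ := this
      simp only [wordPorts, List.mem_filter, Bool.and_eq_true] at hu
      have hub : u ∈ pathWords k m e₀ e₁ (b x, b y) :=
        List.mem_filter.2 ⟨List.mem_range.2 (hlt hu.1), hu.2.1⟩
      refine (hfib a hf p hp u hu.1).trans (Relation.ReflTransGen.head ?_ (ih hab.2.1 u hub))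
      exact ⟨h.paint_mem hf hu.1, h.paint_mem hab.2.1 hub,
        h.localStep_paint_of_localStep hf hab.2.1 hab.2.2 u⟩

/-! ### Finite verifications -/

section checks

set_option maxRecDepth 100000

theorem totalCheck_isolated_four : TotalCheck 4 1 1 false false true := by
  unfold TotalCheck; decide +kernel

theorem totalCheck_pendant_four : TotalCheck 4 1 1 true false true := by
  unfold TotalCheck; decide +kernel

theorem totalCheck_ear_four : TotalCheck 4 2 1 true true false := by
  unfold TotalCheck; decide +kernel

theorem totalCheck_isolated_three : TotalCheck 3 1 2 false false true := by
  unfold TotalCheck; decide +kernel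

/-- Two new vertices are needed here: with one, the only port for a change from `a` to `b` is the
third color, so a traversal entering there could not leave. -/
theorem totalCheck_pendant_three : TotalCheck 3 2 2 true false true := by
  unfold TotalCheck; decide +kernel

theorem totalCheck_ear_three_three : ∀ d, TotalCheck 3 3 2 true true d := by
  unfold TotalCheck; decide +kernel

theorem totalCheck_ear_four_three : ∀ d, TotalCheck 3 4 2 true true d := by
  unfold TotalCheck; decide +kernel

theorem tripleCheck_isolated_four : TripleCheck 4 1 1 false false := by
  unfold TripleCheck; decide +kernel

theorem tripleCheck_pendant_four : TripleCheck 4 1 1 true false := by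
  unfold TripleCheck; decide +kernel

theorem tripleCheck_isolated_three : TripleCheck 3 1 2 false false := by
  unfold TripleCheck; decide +kernel

theorem tripleCheck_pendant_three : TripleCheck 3 2 2 true false := by
  unfold TripleCheck; decide +kernel

theorem tripleCheck_ear_three_three : TripleCheck 3 3 2 true true := by
  unfold TripleCheck; decide +kernel

theorem tripleCheck_ear_four_three : TripleCheck 3 4 2 true true := by
  unfold TripleCheck; decide +kernel

theorem connectCheck_isolated : ConnectCheck 3 1 2 false false true := by
  unfold ConnectCheck; decide +kernel

theorem connectCheck_pendant : ConnectCheck 3 1 2 true false true := by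
  unfold ConnectCheck; decide +kernel

theorem connectCheck_ear : ConnectCheck 3 2 2 true true false := by
  unfold ConnectCheck; decide +kernel

/-- The first fibre crossed is taken off the diagonal. Over a diagonal state the six words form a
cycle, where a Hamiltonian path can end only at a neighbour of its start. -/
theorem windowCheck_four : ∀ a b c e : Fin 4, stateStep 4 false (a, b) (c, e) = true →
    (a, b) ≠ (c, e) → c ≠ e → windowCheck 4 2 1 3 (a, b) (c, e) = true := by
  decide +kernel

theorem windowCheck_three_three : ∀ a c e : Fin 3, stateStep 3 false (a, a) (c, e) = true →
    c ≠ e → windowCheck 3 3 2 2 (a, a) (c, e) = true := by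
  decide +kernel

theorem windowCheck_four_three : ∀ a c e : Fin 3, stateStep 3 false (a, a) (c, e) = true →
    c ≠ e → windowCheck 3 4 2 2 (a, a) (c, e) = true := by
  decide +kernel

end checks

/-! ### Ears, and the single vertex -/

theorem PathAttached.hasHamCycle_four {H : SimpleGraph W} {A : Set W} {ι : Fin 2 → W} {x y : W}
    (h : PathAttached H A ι true true x y) (hxy : x ≠ y)
    (hA : HasHamCycle (LocalStep H 1) (coloringsOn H 4 A)) :
    HasHamCycle (LocalStep H 1) (coloringsOn H 4 (A ∪ Set.range ι)) := by
  refine h.hasHamCycle false (by simp [hxy]) hA totalCheck_ear_four fun v N hN hper hstep hv => ?_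
  have hne := exists_state_ne (by norm_num) hA.nonempty h.left_mem hv
  obtain ⟨i, h1, h2⟩ := exists_change_to_offDiag hN hper hstep
    fun s => (hne s s).imp fun n hn => hn.1
  exact exists_funnel_of_windowCheck (n := 3) le_rfl hstep (windowCheck_four _ _ _ _ (hstep i) h1 h2)

/-- If both ends coincide, all states are diagonal and a triple closes the tour. Otherwise `hdiag`
makes the state sequence meet the diagonal, and a window is placed where it leaves. -/
theorem PathAttached.hasHamCycle_three {m : ℕ} (hm : m = 3 ∨ m = 4) {H : SimpleGraph W} {A : Set W}
    {ι : Fin m → W} {x y : W} (h : PathAttached H A ι true true x y) (hxy : ¬H.Adj x y)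
    (hA : HasHamCycle (LocalStep H 2) (coloringsOn H 3 A))
    (hdiag : ∃ f ∈ coloringsOn H 3 A, f x = f y) :
    HasHamCycle (LocalStep H 2) (coloringsOn H 3 (A ∪ Set.range ι)) := by
  by_cases hne : x = y
  · subst hne
    rcases hm with rfl | rfl
    · exact h.hasHamCycle_of_tripleCheck le_rfl hA (totalCheck_ear_three_three true)
        tripleCheck_ear_three_three
    · exact h.hasHamCycle_of_tripleCheck le_rfl hA (totalCheck_ear_four_three true)
        tripleCheck_ear_four_three
  · refine h.hasHamCycle false (by simp [hne, hxy]) hA ?_ fun v N hN hper hstep hv => ?_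
    · rcases hm with rfl | rfl
      · exact totalCheck_ear_three_three false
      · exact totalCheck_ear_four_three false
    have hne := exists_state_ne (by norm_num) hA.nonempty h.left_mem hv
    obtain ⟨f, hf, hfxy⟩ := hdiag
    obtain ⟨i, h1, h2⟩ := exists_change_from_diag hN hper hstep
      (fun s => (hne s s).imp fun n hn => hn.1) ((hv f hf).imp fun n hn => by rw [hn]; exact hfxy)
    have hi : v i = ((v i).1, (v i).1) := Prod.ext rfl h1.symm
    refine exists_funnel_of_windowCheck (n := 2) (i := i) (by norm_num) hstep ?_
    have hs := hstep i
    rw [hi] at hs ⊢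
    rcases hm with rfl | rfl
    · exact windowCheck_three_three _ _ _ hs h2
    · exact windowCheck_four_three _ _ _ hs h2

end coloringsOn

theorem HasHamCycle.singleton {W : Type*} (H : SimpleGraph W) (j k : ℕ) [NeZero k] (hk : 3 ≤ k)
    (v : W) : HasHamCycle (LocalStep H j) (coloringsOn H k {v}) := by
  classical
  have hval : ∀ n, (Function.update (0 : W → Fin k) v (Fin.ofNat k n) v : ℕ) = n % k := fun n => by
    rw [Function.update_self]; rfl
  have hne : ∀ i j', i < j' → j' < i + k → Function.update (0 : W → Fin k) v (Fin.ofNat k i) ≠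
      Function.update (0 : W → Fin k) v (Fin.ofNat k j') := by
    intro i j' hij hji he
    have h := congrArg Fin.val (congrFun he v)
    rw [hval, hval] at h
    have h1 : (j' - i) % k = 0 := Nat.sub_mod_eq_zero_of_mod_eq h.symm
    rw [Nat.mod_eq_of_lt (by omega)] at h1
    omega
  refine ⟨k, fun n => Function.update (0 : W → Fin k) v (Fin.ofNat k n), hk, fun n => ?_, hne,
    fun f => ⟨fun hf => ⟨f v, ?_⟩, ?_⟩, fun n => ⟨hne _ _ (by omega) (by omega), v, v, Or.inl rfl,
      fun w hw => ?_⟩⟩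
  · have : Fin.ofNat k (n + k) = Fin.ofNat k n := Fin.ext (Nat.add_mod_right n k)
    simp only [this]
  · funext w
    beta_reduce
    by_cases hw : w = v
    · subst hw
      rw [Function.update_self]
      exact Fin.ext (Nat.mod_eq_of_lt (f w).2)
    · rw [Function.update_of_ne hw]
      exact (hf.1 w hw).symm
  · rintro ⟨n, rfl⟩
    refine ⟨fun w hw => Function.update_of_ne hw _ _, ?_⟩
    rintro u rfl w rfl huw
    exact absurd huw (H.irrefl)
  · by_contra hne
    have hwv : w ≠ v := fun h => hne (Or.inl h)
    simp only [Function.update_of_ne hwv] at hw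
    exact hw rfl

theorem ConnectsOn.singleton {W : Type*} (H : SimpleGraph W) (j k : ℕ) [NeZero k] (v : W) :
    ConnectsOn (LocalStep H j) (coloringsOn H k {v}) := by
  refine ⟨⟨fun _ => 0, fun _ _ => rfl, ?_⟩, fun f hf g hg => ?_⟩
  · rintro u rfl w rfl huw
    exact absurd huw (H.irrefl)
  · by_cases hfg : f = g
    · rw [hfg]
    · refine Relation.ReflTransGen.single ⟨hf, hg, hfg, v, v, Or.inl rfl, fun w hw => ?_⟩
      by_contra hne
      have hwv : w ≠ v := fun h => hne (Or.inl h)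
      exact hw (by rw [hf.1 w hwv, hg.1 w hwv])

/-- Without a second attaching edge the right anchor plays no role; moving it to `x` makes every
state diagonal. -/
theorem PathAttached.pendant {W : Type*} {H : SimpleGraph W} {A : Set W} {m : ℕ} {ι : Fin m → W}
    {e₀ : Bool} {x y : W} (h : PathAttached H A ι e₀ false x y) :
    PathAttached H A ι e₀ false x x :=
  { h with
    right_mem := h.left_mem
    adj_mem_iff := fun i w hw => by simpa using h.adj_mem_iff i w hw }

/-! ### Building the subdivided graph by attaching paths -/

section subdivision

variable {V E : Type*} {x y : E → V} {s : E → ℕ}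

theorem subdivisionVertex_succ {e : E} {i : ℕ} (h : i < s e) :
    subdivisionVertex x y s e (i + 1) = Sum.inr ⟨e, ⟨i, h⟩⟩ := dif_pos h

theorem subdivisionVertex_last (e : E) : subdivisionVertex x y s e (s e + 1) = Sum.inl (y e) :=
  dif_neg (lt_irrefl _)

theorem subdivisionVertex_eq_inr_iff {e e' : E} {i : Fin (s e)} {j : ℕ} :
    subdivisionVertex x y s e' j = Sum.inr ⟨e, i⟩ ↔ e' = e ∧ j = i + 1 := by
  constructor
  · intro h
    cases j with
    | zero => cases h
    | succ j =>
      by_cases hj : j < s e'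
      · rw [subdivisionVertex_succ hj] at h
        cases h
        exact ⟨rfl, rfl⟩
      · rw [subdivisionVertex, dif_neg hj] at h
        cases h
  · rintro ⟨rfl, rfl⟩
    exact subdivisionVertex_succ i.2

theorem subdivisionGraph_adj_inr_iff {e : E} {i : Fin (s e)} {w : V ⊕ (Σ e : E, Fin (s e))} :
    (subdivisionGraph x y s).Adj (Sum.inr ⟨e, i⟩) w ↔
      w = subdivisionVertex x y s e i ∨ w = subdivisionVertex x y s e (i + 2) := by
  rw [subdivisionGraph, SimpleGraph.fromRel_adj]
  constructor
  · rintro ⟨-, ⟨e', j, -, h, rfl⟩ | ⟨e', j, -, rfl, h⟩⟩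
    · obtain ⟨rfl, rfl⟩ := subdivisionVertex_eq_inr_iff.1 h.symm
      exact Or.inr rfl
    · obtain ⟨rfl, h⟩ := subdivisionVertex_eq_inr_iff.1 h.symm
      obtain rfl : j = i := by omega
      exact Or.inl rfl
  · rintro (rfl | rfl)
    · refine ⟨fun h => ?_, Or.inr ⟨e, i, i.2.le, rfl, (subdivisionVertex_succ i.2).symm⟩⟩
      have := (subdivisionVertex_eq_inr_iff.1 h.symm).2
      omega
    · refine ⟨fun h => ?_, Or.inl ⟨e, i + 1, i.2, (subdivisionVertex_succ i.2).symm, rfl⟩⟩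
      have := (subdivisionVertex_eq_inr_iff.1 h.symm).2
      omega

theorem subdivisionGraph_not_adj_inl (hs : ∀ e, 1 ≤ s e) (u v : V) :
    ¬(subdivisionGraph x y s).Adj (Sum.inl u) (Sum.inl v) := by
  have key : ∀ (u v : V) e j, j ≤ s e → Sum.inl u = subdivisionVertex x y s e j →
      Sum.inl v = subdivisionVertex x y s e (j + 1) → False := by
    intro u v e j hj hu hv
    by_cases h : j < s e
    · rw [subdivisionVertex_succ h] at hv
      cases hv
    · obtain rfl : j = s e := by omega
      obtain ⟨l, hl⟩ : ∃ l, s e = l + 1 := ⟨s e - 1, by have := hs e; omega⟩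
      rw [hl, subdivisionVertex_succ (by omega)] at hu
      cases hu
  rw [subdivisionGraph, SimpleGraph.fromRel_adj]
  rintro ⟨-, ⟨e, j, hj, hu, hv⟩ | ⟨e, j, hj, hv, hu⟩⟩
  · exact key _ _ e j hj hu hv
  · exact key _ _ e j hj hv hu

/-- The vertices of `subdivisionGraph x y s` which are old, or lie on an edge in `F`, or are among
the first `t` new vertices on `e`. -/
def subdivisionPart (V : Type*) {E : Type*} (s : E → ℕ) (F : Set E) (e : E) (t : ℕ) :
    Set (V ⊕ (Σ e : E, Fin (s e))) :=
  {z | ∀ e' i, z = Sum.inr ⟨e', i⟩ → e' ∈ F ∨ e' = e ∧ (i : ℕ) < t}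

theorem inl_mem_subdivisionPart {F : Set E} {e : E} {t : ℕ} (v : V) :
    Sum.inl v ∈ subdivisionPart V s F e t := fun e' i h => by cases h

theorem inr_mem_subdivisionPart {F : Set E} {e e' : E} {t : ℕ} {i : Fin (s e')} :
    Sum.inr ⟨e', i⟩ ∈ subdivisionPart V s F e t ↔ e' ∈ F ∨ e' = e ∧ (i : ℕ) < t := by
  constructor
  · intro h
    exact h e' i rfl
  · intro h e'' i' he
    cases he
    exact h

theorem pathAttached_subdivisionPart {F : Set E} {e : E} (he : e ∉ F) {t m : ℕ} (hm : 0 < m)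
    (htm : t + m ≤ s e) :
    PathAttached (subdivisionGraph x y s) (subdivisionPart V s F e t)
      (fun i : Fin m => Sum.inr ⟨e, ⟨t + i, by omega⟩⟩) true (decide (t + m = s e))
      (subdivisionVertex x y s e t) (Sum.inl (y e)) where
  pos := hm
  inj i j h := by
    simp only [Sum.inr.injEq, Sigma.mk.injEq, heq_eq_eq, true_and, Fin.mk.injEq] at h
    exact Fin.ext (by omega)
  notMem i := by
    rw [inr_mem_subdivisionPart]
    simp [he]
  left_mem := by
    cases t with
    | zero => exact inl_mem_subdivisionPart _
    | succ t =>
      rw [subdivisionVertex_succ (by omega), inr_mem_subdivisionPart]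
      simp
  right_mem := inl_mem_subdivisionPart _
  adj_iff i j := by
    simp only [subdivisionGraph_adj_inr_iff, eq_comm (a := Sum.inr _),
      subdivisionVertex_eq_inr_iff, true_and]
    omega
  adj_mem_iff i w hw := by
    rw [subdivisionGraph_adj_inr_iff]
    simp only [true_and, decide_eq_true_eq]
    have hi := i.2
    constructor
    · rintro (rfl | rfl)
      · left
        by_cases h0 : (i : ℕ) = 0
        · simp [h0]
        · exfalso
          have h1 : t + (i : ℕ) = (t + i - 1) + 1 := by omega
          rw [h1, subdivisionVertex_succ (by omega), inr_mem_subdivisionPart] at hw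
          simp only [he, true_and, false_or] at hw
          omega
      · right
        by_cases h1 : t + (i : ℕ) + 1 < s e
        · rw [subdivisionVertex_succ h1, inr_mem_subdivisionPart] at hw
          simp only [he, true_and, false_or] at hw
          omega
        · have h2 : t + (i : ℕ) + 1 = s e := by omega
          refine ⟨by omega, by omega, ?_⟩
          change subdivisionVertex x y s e (t + i + 1 + 1) = _
          rw [h2, subdivisionVertex_last]
    · rintro (⟨hi, rfl⟩ | ⟨h1, h2, rfl⟩)
      · left; simp [hi]
      · right
        change _ = subdivisionVertex x y s e (t + i + 1 + 1)
        rw [show t + (i : ℕ) + 1 = s e by omega, subdivisionVertex_last]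

theorem subdivisionPart_union_range {F : Set E} {e : E} {t m : ℕ} (htm : t + m ≤ s e) :
    subdivisionPart V s F e t ∪ Set.range
      (fun i : Fin m => (Sum.inr ⟨e, ⟨t + i, by omega⟩⟩ : V ⊕ (Σ e : E, Fin (s e)))) =
      subdivisionPart V s F e (t + m) := by
  ext z
  rw [Set.mem_union]
  rcases z with v | ⟨e', i⟩
  · simp only [inl_mem_subdivisionPart, true_or]
  · rw [inr_mem_subdivisionPart, inr_mem_subdivisionPart]
    constructor
    · rintro ((h | h) | ⟨l, h⟩)
      · exact Or.inl h
      · exact Or.inr ⟨h.1, by omega⟩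
      · cases h
        exact Or.inr ⟨rfl, by simp⟩
    · rintro (h | ⟨rfl, h⟩)
      · exact Or.inl (Or.inl h)
      · by_cases hi : (i : ℕ) < t
        · exact Or.inl (Or.inr ⟨rfl, hi⟩)
        · refine Or.inr ⟨⟨i - t, by omega⟩, ?_⟩
          simp only [Sum.inr.injEq, Sigma.mk.injEq, heq_eq_eq, true_and]
          exact Fin.ext (by simp; omega)

theorem subdivisionPart_full {F : Set E} {e : E} :
    subdivisionPart V s F e (s e) = subdivisionPart V s (insert e F) e 0 := by
  ext z
  rcases z with v | ⟨e', i⟩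
  · simp only [inl_mem_subdivisionPart]
  · rw [inr_mem_subdivisionPart, inr_mem_subdivisionPart, Set.mem_insert_iff]
    constructor
    · rintro (h | ⟨h, -⟩)
      · exact Or.inl (Or.inr h)
      · exact Or.inl (Or.inl h)
    · rintro ((rfl | h) | h)
      · exact Or.inr ⟨rfl, i.2⟩
      · exact Or.inl h
      · omega

/-- Before the last new vertex, the far end can be met only as a predecessor, that is, at `t = 1` on
a loop. -/
theorem subdivisionGraph_not_adj_last (hs : ∀ e, 1 ≤ s e) {e : E} {t : ℕ} (ht : t < s e)
    (h : x e ≠ y e ∨ t ≠ 1) :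
    ¬(subdivisionGraph x y s).Adj (subdivisionVertex x y s e t) (Sum.inl (y e)) := by
  rcases t with _ | t
  · exact subdivisionGraph_not_adj_inl hs _ _
  · rw [subdivisionVertex_succ (by omega), subdivisionGraph_adj_inr_iff, not_or]
    constructor
    · rcases t with _ | t
      · intro he
        rcases h with h | h
        · exact h (Sum.inl_injective he).symm
        · exact h rfl
      · rw [subdivisionVertex_succ (by omega)]
        exact Sum.inl_ne_inr
    · change _ ≠ subdivisionVertex x y s e (t + 1 + 1)
      rw [subdivisionVertex_succ ht]
      exact Sum.inl_ne_inr

theorem subdivisionVertex_ne_last {e : E} (hxy : x e ≠ y e) {t : ℕ} (ht : t < s e) :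
    subdivisionVertex x y s e t ≠ Sum.inl (y e) := by
  rcases t with _ | t
  · exact fun h => hxy (Sum.inl_injective h)
  · rw [subdivisionVertex_succ (by omega)]
    exact Sum.inr_ne_inl

/-- A property of sets of vertices of `subdivisionGraph x y s` holds for the set of old vertices if
it holds for single old vertices and is preserved when an isolated vertex is added. -/
theorem range_inl_induction [Finite V] [Nonempty V] (hs : ∀ e, 1 ≤ s e)
    (Q : Set (V ⊕ (Σ e : E, Fin (s e))) → Prop) (hbase : ∀ z, Q {z})
    (hiso : ∀ A (ι : Fin 1 → V ⊕ (Σ e : E, Fin (s e))) u,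
      PathAttached (subdivisionGraph x y s) A ι false false u u → Q A → Q (A ∪ Set.range ι)) :
    Q (Set.range Sum.inl) := by
  have key : ∀ T : Set V, T.Nonempty → Q (Sum.inl '' T) := by
    intro T hT
    induction T, Set.toFinite T using Set.Finite.induction_on with
    | empty => exact absurd hT (by simp)
    | @insert v T hv _ ih =>
      rcases T.eq_empty_or_nonempty with rfl | ⟨u, hu⟩
      · simpa using hbase (Sum.inl v)
      -- `u` is any vertex already present; its color only serves as the state.
      · have := hiso (Sum.inl '' T) (fun _ => Sum.inl v) (Sum.inl u)
          { pos := Nat.one_pos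
            inj := Function.injective_of_subsingleton _
            notMem := fun _ => by simpa using hv
            left_mem := ⟨u, hu, rfl⟩
            right_mem := ⟨u, hu, rfl⟩
            adj_iff := fun i j => by
              refine iff_of_false (SimpleGraph.irrefl _) (by omega)
            adj_mem_iff := by
              rintro i w ⟨z, -, rfl⟩
              simpa using subdivisionGraph_not_adj_inl hs v z } (ih ⟨u, hu⟩)
        rwa [Set.range_const, Set.union_singleton, ← Set.image_insert_eq] at this
  simpa using key Set.univ Set.univ_nonempty

theorem univ_induction [Finite E] (Q : Set (V ⊕ (Σ e : E, Fin (s e))) → Prop)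
    (hbase : Q (Set.range Sum.inl))
    (hedge : ∀ F e, e ∉ F → Q (subdivisionPart V s F e 0) → Q (subdivisionPart V s F e (s e))) :
    Q Set.univ := by
  have key : ∀ F : Set E, Q {z | ∀ e i, z = Sum.inr ⟨e, i⟩ → e ∈ F} := by
    intro F
    induction F, Set.toFinite F using Set.Finite.induction_on with
    | empty =>
      convert hbase using 1
      ext z
      rcases z with v | ⟨e, i⟩ <;> simp
    | @insert e F he _ ih =>
      have h := hedge F e he (by simpa [subdivisionPart] using ih)
      rw [subdivisionPart_full] at h
      simpa [subdivisionPart] using h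
  simpa using key Set.univ

end subdivision

/-! ### The three inductions over the edges -/

section subdivision

variable {V E : Type*} {x y : E → V} {s : E → ℕ} [Finite V] [Finite E] [Nonempty V]

/-- Pendant vertices are added singly until two new vertices remain for the ear, whose ends differ
because no edge is a loop. -/
theorem hasHamCycle_subdivisionGraph_four (hs : ∀ e, 2 ≤ s e) (hxy : ∀ e, x e ≠ y e) :
    HasHamCycle (LocalStep (subdivisionGraph x y s) 1)
      (coloringsOn (subdivisionGraph x y s) 4 Set.univ) := by
  refine univ_induction
    (fun A => HasHamCycle (LocalStep _ 1) (coloringsOn (subdivisionGraph x y s) 4 A))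
    (range_inl_induction (x := x) (y := y) (fun e => one_le_two.trans (hs e)) _
      (fun z => HasHamCycle.singleton _ _ _ (by norm_num) z) fun A ι u h hA =>
        h.hasHamCycle_of_tripleCheck (by norm_num) hA totalCheck_isolated_four
          tripleCheck_isolated_four) fun F e he hF => ?_
  have hpre : ∀ t, t + 2 ≤ s e → HasHamCycle (LocalStep (subdivisionGraph x y s) 1)
      (coloringsOn (subdivisionGraph x y s) 4 (subdivisionPart V s F e t)) := by
    intro t
    induction t with
    | zero => exact fun _ => hF
    | succ t ih =>
      intro ht
      have h := pathAttached_subdivisionPart (x := x) (y := y) he Nat.one_pos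
        (by omega : t + 1 ≤ s e)
      rw [decide_eq_false (by omega)] at h
      rw [← subdivisionPart_union_range (by omega)]
      exact h.pendant.hasHamCycle_of_tripleCheck (by norm_num) (ih (by omega))
        totalCheck_pendant_four tripleCheck_pendant_four
  have he2 : s e - 2 + 2 = s e := Nat.sub_add_cancel (hs e)
  have h := pathAttached_subdivisionPart (x := x) (y := y) he Nat.two_pos he2.le
  rw [decide_eq_true he2] at h
  have := h.hasHamCycle_four (subdivisionVertex_ne_last (hxy e) (by have := hs e; omega))
    (hpre _ he2.le)
  rwa [subdivisionPart_union_range he2.le, he2] at this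

theorem connectsOn_subdivisionGraph_three (hs : ∀ e, 2 ≤ s e) (hxy : ∀ e, x e ≠ y e) :
    ConnectsOn (LocalStep (subdivisionGraph x y s) 2)
      (coloringsOn (subdivisionGraph x y s) 3 Set.univ) := by
  have hs1 : ∀ e, 1 ≤ s e := fun e => one_le_two.trans (hs e)
  refine univ_induction
    (fun A => ConnectsOn (LocalStep _ 2) (coloringsOn (subdivisionGraph x y s) 3 A))
    (range_inl_induction (x := x) (y := y) hs1 _
      (fun z => ConnectsOn.singleton _ _ _ z) fun A ι u h hA =>
        h.connectsOn true (by simp) hA connectCheck_isolated) fun F e he hF => ?_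
  have hpre : ∀ t, t + 2 ≤ s e → ConnectsOn (LocalStep (subdivisionGraph x y s) 2)
      (coloringsOn (subdivisionGraph x y s) 3 (subdivisionPart V s F e t)) := by
    intro t
    induction t with
    | zero => exact fun _ => hF
    | succ t ih =>
      intro ht
      have h := pathAttached_subdivisionPart (x := x) (y := y) he Nat.one_pos
        (by omega : t + 1 ≤ s e)
      rw [decide_eq_false (by omega)] at h
      rw [← subdivisionPart_union_range (by omega)]
      exact h.pendant.connectsOn true (by simp) (ih (by omega)) connectCheck_pendant
  have he2 : s e - 2 + 2 = s e := Nat.sub_add_cancel (hs e)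
  have hlt : s e - 2 < s e := by have := hs e; omega
  have h := pathAttached_subdivisionPart (x := x) (y := y) he Nat.two_pos he2.le
  rw [decide_eq_true he2] at h
  have := h.connectsOn false
    (by simpa using ⟨subdivisionVertex_ne_last (hxy e) hlt,
      subdivisionGraph_not_adj_last hs1 hlt (Or.inl (hxy e))⟩)
    (hpre _ he2.le) connectCheck_ear
  rwa [subdivisionPart_union_range he2.le, he2] at this

/-- The induction also carries a coloring that is `0` on all old vertices and at the tip of the
growing path: it supplies the diagonal state needed for the ear. -/
theorem hasHamCycle_subdivisionGraph_three (hs : ∀ e, 3 ≤ s e) :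
    HasHamCycle (LocalStep (subdivisionGraph x y s) 2)
      (coloringsOn (subdivisionGraph x y s) 3 Set.univ) := by
  have hs1 : ∀ e, 1 ≤ s e := fun e => le_trans (by norm_num) (hs e)
  refine (univ_induction
    (fun A => HasHamCycle (LocalStep _ 2) (coloringsOn (subdivisionGraph x y s) 3 A) ∧
      ∃ f ∈ coloringsOn (subdivisionGraph x y s) 3 A, ∀ v, f (Sum.inl v) = 0)
    ⟨range_inl_induction (x := x) (y := y) hs1 _
      (fun z => HasHamCycle.singleton _ _ _ (by norm_num) z) fun A ι u h hA =>
        h.hasHamCycle_of_tripleCheck le_rfl hA totalCheck_isolated_three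
          tripleCheck_isolated_three, 0, ⟨fun _ _ => rfl, ?_⟩, fun _ => rfl⟩
    fun F e he hF => ?_).1
  · rintro _ ⟨u, rfl⟩ _ ⟨v, rfl⟩ huv
    exact absurd huv (subdivisionGraph_not_adj_inl hs1 u v)
  have hpre : ∀ t, 2 * t + 3 ≤ s e → HasHamCycle (LocalStep (subdivisionGraph x y s) 2)
      (coloringsOn (subdivisionGraph x y s) 3 (subdivisionPart V s F e (2 * t))) ∧
      ∃ f ∈ coloringsOn (subdivisionGraph x y s) 3 (subdivisionPart V s F e (2 * t)),
        (∀ v, f (Sum.inl v) = 0) ∧ f (subdivisionVertex x y s e (2 * t)) = 0 := by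
    intro t
    induction t with
    | zero =>
      intro _
      obtain ⟨hF, f, hf, hf0⟩ := hF
      exact ⟨hF, f, hf, hf0, hf0 _⟩
    | succ t ih =>
      intro ht
      have h := pathAttached_subdivisionPart (x := x) (y := y) he Nat.two_pos
        (by omega : 2 * t + 2 ≤ s e)
      rw [decide_eq_false (by omega)] at h
      obtain ⟨hham, f, hf, hf0, hfe⟩ := ih (by omega)
      rw [show 2 * (t + 1) = 2 * t + 2 by ring, ← subdivisionPart_union_range (by omega)]
      -- In base 3, `1` encodes the word 1, 0, which returns the tip to color `0`.
      refine ⟨h.pendant.hasHamCycle_of_tripleCheck le_rfl hham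
        totalCheck_pendant_three tripleCheck_pendant_three, _,
        h.pendant.paint_mem hf (n := 1) ?_, fun v => ?_, ?_⟩
      · rw [hfe]
        decide
      · rw [h.paint_apply_mem f _ (inl_mem_subdivisionPart v), hf0]
      · rw [subdivisionVertex_succ (by omega)]
        exact Fin.ext (h.paint_apply f 1 1)
  -- Pendant pairs preserve the parity of what remains, hence the two ear lengths.
  obtain ⟨t, m, hm, htm⟩ : ∃ t m, (m = 3 ∨ m = 4) ∧ 2 * t + m = s e := by
    have := hs e
    rcases Nat.even_or_odd' (s e) with ⟨l, hl | hl⟩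
    · exact ⟨l - 2, 4, Or.inr rfl, by omega⟩
    · exact ⟨l - 1, 3, Or.inl rfl, by omega⟩
  obtain ⟨hham, f, hf, hf0, hfe⟩ := hpre t (by omega)
  have h := pathAttached_subdivisionPart (x := x) (y := y) he (m := m) (by omega) htm.le
  rw [decide_eq_true htm] at h
  have hfy : f (subdivisionVertex x y s e (2 * t)) = f (Sum.inl (y e)) := by rw [hfe, hf0]
  -- The index `2 * t` is even, so it is not `1` and the ends are nonadjacent even on a loop.
  have hham' := h.hasHamCycle_three hm
    (subdivisionGraph_not_adj_last hs1 (by omega) (Or.inr (by omega))) hham ⟨f, hf, hfy⟩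
  -- In base 3, `16` and `70` encode 1, 2, 1 and 1, 2, 1, 2, which avoid `0` at both ends.
  have hword : ∃ n, n ∈ pathWords 3 m true true (0, 0) := by
    rcases hm with rfl | rfl
    · exact ⟨16, by decide⟩
    · exact ⟨70, by decide⟩
  obtain ⟨n, hn⟩ := hword
  rw [← htm, ← subdivisionPart_union_range htm.le]
  refine ⟨hham', _, h.paint_mem hf (n := n) (by rwa [hfe, hf0]), fun v => ?_⟩
  rw [h.paint_apply_mem f _ (inl_mem_subdivisionPart v), hf0]

end subdivision

/-! ### Transfer to the localized coloring graph -/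

section transfer

variable {W U : Type*}

theorem LocalStep.comp_iso {H : SimpleGraph W} {K : SimpleGraph U} (φ : H ≃g K) {j : ℕ}
    {κ : Type*} {f g : U → κ} (h : LocalStep K j f g) : LocalStep H j (f ∘ φ) (g ∘ φ) := by
  obtain ⟨hne, u, v, huv, hw⟩ := h
  refine ⟨fun he => hne (φ.surjective.injective_comp_right he), φ.symm u, φ.symm v, ?_,
    fun w hwne => ?_⟩
  · rcases huv with rfl | ⟨hj, huv⟩
    · exact Or.inl rfl
    · exact Or.inr ⟨hj, φ.symm.map_adj_iff.2 huv⟩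
  · rcases hw (φ w) hwne with h | h
    · exact Or.inl (by rw [← h]; simp)
    · exact Or.inr (by rw [← h]; simp)

/-- The coloring of `H` which corresponds, under an isomorphism, to a coloring on all vertices. -/
def coloringOfIso {H : SimpleGraph W} {K : SimpleGraph U} (φ : H ≃g K) {k : ℕ} [NeZero k]
    (f : U → Fin k) (hf : f ∈ coloringsOn K k Set.univ) : H.Coloring (Fin k) :=
  SimpleGraph.Coloring.mk (f ∘ φ) fun huv =>
    hf.2 _ (Set.mem_univ _) _ (Set.mem_univ _) (φ.map_adj_iff.2 huv)

theorem LocalStep.adj_localColoringGraph {H : SimpleGraph W} {j k : ℕ} (hj : 1 ≤ j)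
    {f g : H.Coloring (Fin k)} (h : LocalStep H j f g) : (H.localColoringGraph j k).Adj f g := by
  obtain ⟨hne, u, v, huv, hw⟩ := h
  refine ⟨fun he => hne (by rw [he]), ?_⟩
  by_cases he : u = v
  · subst he
    refine ⟨H.singletonSubgraph u, SimpleGraph.Subgraph.singletonSubgraph_connected, ?_,
      fun w hne => ?_⟩
    · rw [SimpleGraph.singletonSubgraph_verts, Set.encard_singleton]
      exact_mod_cast hj
    · simpa using hw w hne
  · obtain ⟨hj2, hadj⟩ := huv.resolve_left he
    subst hj2
    refine ⟨H.subgraphOfAdj hadj, SimpleGraph.Subgraph.subgraphOfAdj_connected hadj, ?_,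
      fun w hne => ?_⟩
    · rw [SimpleGraph.subgraphOfAdj_verts]
      exact (Set.encard_insert_le {v} u).trans (by rw [Set.encard_singleton]; norm_num)
    · simpa using hw w hne

theorem exists_coloringOfIso {H : SimpleGraph W} {K : SimpleGraph U} (φ : H ≃g K) {k : ℕ}
    [NeZero k] (c : H.Coloring (Fin k)) :
    ∃ (f : U → Fin k) (hf : f ∈ coloringsOn K k Set.univ), coloringOfIso φ f hf = c := by
  refine ⟨c ∘ φ.symm, ⟨fun v hv => absurd (Set.mem_univ v) hv, fun u _ v _ huv => ?_⟩, ?_⟩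
  · exact c.valid (φ.symm.map_adj_iff.2 huv)
  · refine DFunLike.ext _ _ fun w => ?_
    change c (φ.symm (φ w)) = c w
    rw [φ.symm_apply_apply]

theorem ConnectsOn.connected {H : SimpleGraph W} {K : SimpleGraph U} (φ : H ≃g K) {j k : ℕ}
    [NeZero k] (hj : 1 ≤ j) (h : ConnectsOn (LocalStep K j) (coloringsOn K k Set.univ)) :
    (H.localColoringGraph j k).Connected := by
  obtain ⟨⟨f₀, hf₀⟩, hconn⟩ := h
  refine { preconnected := fun c c' => ?_, nonempty := ⟨coloringOfIso φ f₀ hf₀⟩ }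
  obtain ⟨f, hf, rfl⟩ := exists_coloringOfIso φ c
  obtain ⟨g, hg, rfl⟩ := exists_coloringOfIso φ c'
  have hfg := hconn f hf g hg
  induction hfg with
  | refl => exact SimpleGraph.Reachable.refl _
  | @tail a b _ hab ih =>
    exact (ih hab.1).trans (SimpleGraph.Adj.reachable
      (LocalStep.adj_localColoringGraph hj (hab.2.2.comp_iso φ)))

/-- The walk of length `N - 1` from `c 1` ends at `c N = c 0`; the edge from `c 0` to `c 1` closes
it. -/
theorem SimpleGraph.isHamiltonian_of_hasHamCycle {α : Type*} [Fintype α] [DecidableEq α]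
    {G : SimpleGraph α} (h : HasHamCycle G.Adj Set.univ) : G.IsHamiltonian := by
  obtain ⟨N, c, hN, hper, hinj, hmem, hadj⟩ := h
  have hmod : ∀ n, c (n % N) = c n := fun n => by
    have : ∀ a b, c (b + N * a) = c b := fun a b => by
      induction a with
      | zero => simp
      | succ a ih => rw [Nat.mul_succ, ← Nat.add_assoc, hper, ih]
    rw [← this (n / N) (n % N), Nat.mod_add_div]
  have hwalk : ∀ n i, ∃ p : G.Walk (c i) (c (i + n)), p.support = (List.range (n + 1)).map
      (fun m => c (i + m)) := by
    intro n
    induction n with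
    | zero => exact fun i => ⟨SimpleGraph.Walk.nil, by simp⟩
    | succ n ih =>
      intro i
      obtain ⟨p, hp⟩ := ih (i + 1)
      refine ⟨SimpleGraph.Walk.cons (hadj i) (p.copy rfl (by congr 1; omega)), ?_⟩
      rw [SimpleGraph.Walk.support_cons, SimpleGraph.Walk.support_copy, hp,
        List.range_succ_eq_map (n := n + 1), List.map_cons, List.map_map]
      congr 1
      refine List.map_congr_left fun m _ => ?_
      simp only [Function.comp]
      congr 1
      omega
  intro _
  obtain ⟨p, hp⟩ := hwalk (N - 1) 1
  have hN1 : c (1 + (N - 1)) = c 0 := by rw [show 1 + (N - 1) = 0 + N by omega, hper]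
  set q : G.Walk (c 0) (c 0) := SimpleGraph.Walk.cons (hadj 0) (p.copy rfl hN1) with hq
  have hqs : q.support.tail = (List.range N).map (fun m => c (1 + m)) := by
    rw [hq, SimpleGraph.Walk.support_cons, List.tail_cons, SimpleGraph.Walk.support_copy, hp,
      Nat.sub_add_cancel (by omega)]
  have hnd : q.support.tail.Nodup := by
    rw [hqs]
    refine List.nodup_range.map_on fun a ha b hb hab => ?_
    rw [List.mem_range] at ha hb
    by_contra hne
    rcases Nat.lt_or_gt_of_ne hne with h | h
    · exact hinj _ _ (by omega) (by omega) hab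
    · exact hinj _ _ (by omega) (by omega) hab.symm
  have hlen : q.length = N := by
    have := congrArg List.length hqs
    simpa using this
  refine ⟨c 0, q, ?_⟩
  rw [SimpleGraph.Walk.isHamiltonianCycle_iff_isCycle_and_support_count_tail_eq_one]
  refine ⟨?_, fun a => ?_⟩
  · rw [SimpleGraph.Walk.isCycle_iff_isPath_tail_and_le_length, hlen,
      SimpleGraph.Walk.isPath_def, SimpleGraph.Walk.support_tail_of_not_nil q
        (SimpleGraph.Walk.not_nil_cons)]
    exact ⟨hnd, hN⟩
  · refine List.count_eq_one_of_mem hnd ?_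
    obtain ⟨n, rfl⟩ := (hmem a).1 (Set.mem_univ a)
    rw [hqs, List.mem_map]
    refine ⟨(n + N - 1) % N, List.mem_range.2 (Nat.mod_lt _ (by omega)), ?_⟩
    rw [← hmod, Nat.add_mod_mod, hmod, show 1 + (n + N - 1) = n + N by omega, hper]

theorem HasHamCycle.isHamiltonian {H : SimpleGraph W} {K : SimpleGraph U} (φ : H ≃g K) {j k : ℕ}
    [NeZero k] (hj : 1 ≤ j) (h : HasHamCycle (LocalStep K j) (coloringsOn K k Set.univ))
    [Fintype (H.Coloring (Fin k))] [DecidableEq (H.Coloring (Fin k))] :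
    (H.localColoringGraph j k).IsHamiltonian := by
  obtain ⟨N, c, hN, hper, hinj, hmem, hadj⟩ := h
  refine SimpleGraph.isHamiltonian_of_hasHamCycle
    ⟨N, fun n => coloringOfIso φ (c n) ((hmem _).2 ⟨n, rfl⟩), hN, fun n => ?_, fun a b hab hba he => ?_,
      fun d => ⟨fun _ => ?_, fun _ => Set.mem_univ _⟩, fun n =>
        LocalStep.adj_localColoringGraph hj ((hadj n).comp_iso φ)⟩
  · simp only [hper]
  · refine hinj a b hab hba (φ.surjective.injective_comp_right ?_)
    exact congrArg (fun d : H.Coloring (Fin k) => (d : W → Fin k)) he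
  · obtain ⟨f, hf, rfl⟩ := exists_coloringOfIso φ d
    obtain ⟨n, rfl⟩ := (hmem f).1 hf
    exact ⟨n, rfl⟩

theorem HasHamCycle.nontrivial_coloring {H : SimpleGraph W} {K : SimpleGraph U} (φ : H ≃g K)
    {j k : ℕ} [NeZero k] (h : HasHamCycle (LocalStep K j) (coloringsOn K k Set.univ)) :
    Nontrivial (H.Coloring (Fin k)) := by
  obtain ⟨N, c, hN, -, hinj, hmem, -⟩ := h
  refine ⟨coloringOfIso φ (c 0) ((hmem _).2 ⟨0, rfl⟩), coloringOfIso φ (c 1) ((hmem _).2 ⟨1, rfl⟩),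
    fun he => hinj 0 1 (by omega) (by omega) (φ.surjective.injective_comp_right ?_)⟩
  exact congrArg (fun d : H.Coloring (Fin k) => (d : W → Fin k)) he

theorem SimpleGraph.not_adj_localColoringGraph_zero (H : SimpleGraph W) {k : ℕ}
    (c d : H.Coloring (Fin k)) : ¬(H.localColoringGraph 0 k).Adj c d := by
  rintro ⟨-, F, hF, hcard, -⟩
  have : F.verts = ∅ := by simpa using hcard
  exact hF.nonempty.ne_empty this

theorem SimpleGraph.IsHamiltonian.exists_adj {α : Type*} [Fintype α] [DecidableEq α] [Nontrivial α]
    {G : SimpleGraph α} (h : G.IsHamiltonian) : ∃ a b, G.Adj a b := by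
  obtain ⟨a, p, hp⟩ := h Fintype.one_lt_card.ne'
  exact ⟨_, _, p.adj_snd hp.isCycle.not_nil⟩

end transfer

/-! ### The theorem -/

theorem theorem3 {α β W : Type*} [Fintype W] [Nonempty W] (M : Graph α β) (H : SimpleGraph W) :
    (M.Loopless → H.IsSubdividedAtLeast 2 M → H.mixingNumber 3 ≤ 2 ∧ H.grayCodeNumber 4 = 1) ∧
    (H.IsSubdividedAtLeast 3 M → H.grayCodeNumber 3 ≤ 2) := by
  -- Finiteness of the multigraph is inherited from `W`, since each edge owns a new vertex.
  have hfin : ∀ (x y : M.edgeSet → M.vertexSet) (s : M.edgeSet → ℕ), (∀ e, 1 ≤ s e) →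
      (H ≃g subdivisionGraph x y s) →
      Finite M.vertexSet ∧ Finite M.edgeSet ∧ Nonempty M.vertexSet := by
    intro x y s hs φ
    have hU : Finite (M.vertexSet ⊕ (Σ e : M.edgeSet, Fin (s e))) := Finite.of_equiv W φ.toEquiv
    refine ⟨Finite.of_injective Sum.inl (Sum.inl_injective (β := Σ e : M.edgeSet, Fin (s e))),
      Finite.of_injective (fun e => (Sum.inr ⟨e, ⟨0, hs e⟩⟩ :
        M.vertexSet ⊕ (Σ e : M.edgeSet, Fin (s e)))) fun e e' h => ?_, ?_⟩
    · cases h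
      rfl
    · obtain ⟨w⟩ := ‹Nonempty W›
      rcases φ w with v | ⟨e, -⟩
      · exact ⟨v⟩
      · exact ⟨x e⟩
  refine ⟨fun hM hH => ?_, fun hH => ?_⟩
  · obtain ⟨x, y, s, hlink, hs, ⟨φ⟩⟩ := hH
    obtain ⟨_, _, _⟩ := hfin x y s (fun e => one_le_two.trans (hs e)) φ
    have hxy : ∀ e, x e ≠ y e := fun e he => by
      have := hlink e
      rw [← he] at this
      exact hM.not_isLoopAt _ _ this
    refine ⟨iInf₂_le_of_le 2 ((connectsOn_subdivisionGraph_three hs hxy).connected φ one_le_two)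
      le_rfl, le_antisymm (iInf₂_le_of_le 1 ?_ (by simp)) (le_iInf₂ fun j hj => ?_)⟩
    · exact (hasHamCycle_subdivisionGraph_four hs hxy).isHamiltonian φ le_rfl
    · have hj1 : 1 ≤ j := by
        by_contra hj0
        obtain rfl : j = 0 := by omega
        -- A one-vertex graph counts as Hamiltonian, so ruling out `j = 0` requires two colorings.
        have := (hasHamCycle_subdivisionGraph_four hs hxy).nontrivial_coloring φ
        obtain ⟨c, d, hcd⟩ := SimpleGraph.IsHamiltonian.exists_adj hj
        exact H.not_adj_localColoringGraph_zero c d hcd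
      exact_mod_cast hj1
  · obtain ⟨x, y, s, hlink, hs, ⟨φ⟩⟩ := hH
    obtain ⟨_, _, _⟩ := hfin x y s (fun e => le_trans (by norm_num) (hs e)) φ
    exact iInf₂_le_of_le 2
      ((hasHamCycle_subdivisionGraph_three hs).isHamiltonian φ one_le_two) le_rfl
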